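/- Let $\rho\in[-1,1]$. A sequence of random real matrices $\mathbf X_n=(X_{ij})_{i,j=1}^n$, $n\ge 1$, on a common probability space $(\Omega,\mathcal F,\mathbb P)$ is said to satisfy condition (C0) with correlation $\rho$ if the laws of the entries do not depend on $n$ and, for every $n$, a) the pairs $(X_{ij},X_{ji})$, $1\le i<j\le n$, are independent and identically distributed random vectors; b) $\mathbb E X_{12}=\mathbb E X_{21}=0$, $\mathbb E X_{12}^2=\mathbb E X_{21}^2=1$ and $\max(\mathbb E|X_{12}|^4,\mathbb E|X_{21}|^4)\le M_4$ for some finite constant $M_4$; c) $\mathbb E(X_{12}X_{21})=\rho$; d) the diagonal entries $X_{ii}$ are i.i.d. and independent of the off-diagonal entries, with $\mathbb E X_{11}=0$ and $\mathbb E X_{11}^2<\infty$. For $z\in\mathbb C$ let $s_1\ge\dots\ge s_n\ge 0$ be the singular values of $n^{-1/2}\mathbf X_n-z\mathbf I$, and let $$\mathcal F_n(x,z)=\frac1n\,\#\{1\le i\le n:\ s_i\le x\},\qquad x\in\mathbb R,$$ be their empirical distribution function. **Theorem.** For every $\rho\in[-1,1]$ there is a family of non-random distribution functions $\mathcal F(\cdot,z)$,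 $z\in\mathbb C$, depending only on $\rho$ and $z$ (and not on the distribution of the entries), such that for every sequence $\mathbf X_n$ satisfying (C0) with correlation $\rho$, for almost all $z\in\mathbb C$ (with respect to Lebesgue measure), for all bounded continuous functions $f:\mathbb R\to\mathbb C$ and all $\varepsilon>0$, $$\mathbb P\left(\left|\int_{\mathbb R} f(x)\,d\mathcal F_n(x,z)-\int_{\mathbb R} f(x)\,d\mathcal F(x,z)\right|>\varepsilon\right)\longrightarrow 0\qquad (n\to\infty).$$ -/

import Mathlib

open MeasureTheory ProbabilityTheory Filter Topology
open scoped BoundedContinuousFunction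

/-- Condition (C0) for a sequence of random real `n × n` matrices `X n = (X n i j)`, defined on one
probability space, whose entry laws do not depend on `n`.  The pairs `(X i j, X j i)` are indexed
by the unordered off-diagonal positions, that is by `i < j`; no exchangeability inside a pair is
assumed. -/
structure ConditionC0 {Ω : Type*} [MeasurableSpace Ω] (P : Measure Ω) (ρ M₄ : ℝ)
    (X : (n : ℕ) → Fin n → Fin n → Ω → ℝ) : Prop where
  /-- the entries are random variables -/
  measurable : ∀ n i j, Measurable (X n i j)
  /-- the off-diagonal pairs are independent -/
  indep_pairs : ∀ n, iIndepFun
    (fun (p : {p : Fin n × Fin n // p.1 < p.2}) (ω : Ω) =>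
      (X n p.1.1 p.1.2 ω, X n p.1.2 p.1.1 ω)) P
  /-- the off-diagonal pairs are identically distributed -/
  ident_pairs : ∀ n m (i j : Fin n) (k l : Fin m), i < j → k < l →
    IdentDistrib (fun ω => (X n i j ω, X n j i ω)) (fun ω => (X m k l ω, X m l k ω)) P P
  /-- off-diagonal entries have finite fourth moment -/
  memLp_offDiag : ∀ n (i j : Fin n), i ≠ j → MemLp (X n i j) 4 P
  mean_offDiag : ∀ n (i j : Fin n), i ≠ j → ∫ ω, X n i j ω ∂P = 0
  variance_offDiag : ∀ n (i j : Fin n), i ≠ j → ∫ ω, X n i j ω ^ 2 ∂P = 1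
  fourth_moment_offDiag : ∀ n (i j : Fin n), i ≠ j → ∫ ω, |X n i j ω| ^ 4 ∂P ≤ M₄
  correlation : ∀ n (i j : Fin n), i ≠ j → ∫ ω, X n i j ω * X n j i ω ∂P = ρ
  /-- the diagonal entries are independent -/
  indep_diag : ∀ n, iIndepFun (fun (i : Fin n) => X n i i) P
  /-- the diagonal entries are identically distributed -/
  ident_diag : ∀ n m (i : Fin n) (k : Fin m), IdentDistrib (X n i i) (X m k k) P P
  /-- the diagonal is independent of the off-diagonal part -/
  indep_diag_offDiag : ∀ n, IndepFun
    (fun (ω : Ω) (i : Fin n) => X n i i ω)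
    (fun (ω : Ω) (p : {p : Fin n × Fin n // p.1 ≠ p.2}) => X n p.1.1 p.1.2 ω) P
  /-- diagonal entries have finite second moment -/
  memLp_diag : ∀ n (i : Fin n), MemLp (X n i i) 2 P
  mean_diag : ∀ n (i : Fin n), ∫ ω, X n i i ω ∂P = 0

/-- The complex matrix `n^{-1/2} A - z I`. -/
noncomputable def shiftedMatrix {n : ℕ} (A : Matrix (Fin n) (Fin n) ℝ) (z : ℂ) :
    Matrix (Fin n) (Fin n) ℂ :=
  ((Real.sqrt n)⁻¹ • A).map Complex.ofReal - z • (1 : Matrix (Fin n) (Fin n) ℂ)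

/-- The empirical measure `n⁻¹ ∑ δ_{s_i(B)}` of the `n` singular values, counted with
multiplicity, of an `n × n` complex matrix `B`. -/
noncomputable def singularValueMeasure {n : ℕ} (B : Matrix (Fin n) (Fin n) ℂ) : Measure ℝ :=
  (n : ENNReal)⁻¹ •
    ∑ i : Fin n, Measure.dirac ((Matrix.toEuclideanLin B).singularValues i)

/-- `F` is the distribution function of a probability measure on `ℝ`
(monotone and right-continuous by its type). -/
def IsDistributionFunction (F : StieltjesFunction ℝ) : Prop :=
  Tendsto F atBot (𝓝 0) ∧ Tendsto F atTop (𝓝 1)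

/-! The singular values of `W = n^{-1/2} A - z` are read off from the Hermitian block matrix with
off-diagonal blocks `W` and `Wᴴ`. The diagonal of its resolvent at `i v` gives `∫ (x² + v²)⁻¹ dμ_n`,
where `μ_n` is the empirical law of the singular values. Weak convergence in probability is
therefore reduced to convergence in probability of these numbers for all large `v`, plus tightness.

Convergence of the numbers. Let `g a b` be the normalized traces of the four blocks of the
resolvent. The limiting equation is `δ_ab + z_a g(!a,b) + i v g(a,b) + g(!a,!a) g(a,b) + ρ g(!a,a)
g(!a,b) = 0`, where `z_a` is `z` or its conjugate; its left side at the empirical `g` is the defect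
`D`. The row identity `(H - i v) R = 1` turns the linear part of `D` into a sum of entry times
resolvent element. In `E |D|² = E (D · conj D)` the first factor is expanded in this way, and for
each off-diagonal position the pair `(X_ij, X_ji)` is deleted from the matrix. A first-order
expansion in the pair, together with its independence from the remaining matrix, lets the mean, the
variance and the correlation `ρ` produce precisely the negative of the quadratic part of `D`. What
remains is `O(n^{-1/2})` (`integral_norm_sq_dysonDefect_le`). Keeping `conj D` as a test factor
gives the self-consistent equation and concentration in one stroke.

For `v ≥ 2(‖z‖ + 4)` the equation is a contraction on the unit ball, so it has a solution and a
small defect forces `g` to be close to it (`exists_dysonDefect_eq_zero`,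
`norm_sub_le_sum_dysonDefect`). Only `ρ`, `z` and `v` enter, whence universality.

From transforms to laws. Knowing `∫ (x² + t)⁻¹ dμ` for `t > t₀` determines `μ`, by differentiation
in `t` and Stone-Weierstrass (`measure_eq_of_forall_integral_inv_sq_add_eq`). The second moment of
`μ_n` is the normalized squared Hilbert-Schmidt norm of `W`, bounded in probability. Compactness
then shows that the limiting transform comes from a probability measure, and that closeness of
finitely many transform values forces closeness of `∫ f`. The argument works at every `z`. -/

open scoped NNReal ENNReal ComplexConjugate

/-! ### The transform by `(x² + t)⁻¹` determines a law on `[0, ∞)` -/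

/-- The bounded continuous function `x ↦ (x² + t)⁻¹` on `[0, ∞)`. -/
noncomputable def resolventTest (t : ℝ) (ht : 0 < t) : ℝ≥0 →ᵇ ℝ :=
  BoundedContinuousFunction.ofNormedAddCommGroup (fun x => ((x : ℝ) ^ 2 + t)⁻¹)
    (Continuous.inv₀ (by fun_prop) (fun x => by positivity)) t⁻¹
    (fun x => by
      rw [Real.norm_of_nonneg (by positivity)]
      exact inv_anti₀ ht (by nlinarith [sq_nonneg (x : ℝ)]))

@[simp] theorem resolventTest_apply (t : ℝ) (ht : 0 < t) (x : ℝ≥0) :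
    resolventTest t ht x = ((x : ℝ) ^ 2 + t)⁻¹ := rfl

theorem integrable_inv_sq_add_pow (μ : Measure ℝ≥0) [IsFiniteMeasure μ] {t : ℝ} (ht : 0 < t)
    (k : ℕ) : Integrable (fun x : ℝ≥0 => (((x : ℝ) ^ 2 + t)⁻¹) ^ k) μ := by
  exact (((resolventTest t ht) ^ k).integrable μ).congr (Eventually.of_forall fun x => by simp)

theorem hasDerivAt_integral_inv_sq_add_pow (μ : Measure ℝ≥0) [IsFiniteMeasure μ] {t : ℝ}
    (ht : 0 < t) (k : ℕ) :
    HasDerivAt (fun t : ℝ => ∫ x : ℝ≥0, (((x : ℝ) ^ 2 + t)⁻¹) ^ k ∂μ)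
      (∫ x : ℝ≥0, -(k : ℝ) * (((x : ℝ) ^ 2 + t)⁻¹) ^ (k + 1) ∂μ) t := by
  have hs : Set.Ioi (t / 2) ∈ 𝓝 t := Ioi_mem_nhds (by linarith)
  refine (hasDerivAt_integral_of_dominated_loc_of_deriv_le (μ := μ)
    (F := fun t (x : ℝ≥0) => (((x : ℝ) ^ 2 + t)⁻¹) ^ k)
    (F' := fun t (x : ℝ≥0) => -(k : ℝ) * (((x : ℝ) ^ 2 + t)⁻¹) ^ (k + 1))
    (bound := fun _ => (k : ℝ) * ((t / 2)⁻¹) ^ (k + 1)) hs ?_ ?_ ?_ ?_ ?_ ?_).2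
  · filter_upwards [hs] with s hs
    exact (integrable_inv_sq_add_pow μ (by have : t / 2 < s := hs; linarith) k).1
  · exact integrable_inv_sq_add_pow μ ht k
  · exact ((integrable_inv_sq_add_pow μ ht (k + 1)).const_mul _).1
  · refine Eventually.of_forall fun x s hs => ?_
    have hs' : t / 2 < s := hs
    have : 0 < s := by linarith
    rw [norm_mul, norm_neg, Real.norm_natCast, Real.norm_of_nonneg (by positivity)]
    gcongr
    nlinarith [sq_nonneg (x : ℝ)]
  · exact integrable_const _
  · refine Eventually.of_forall fun x s hs => ?_
    have hs' : t / 2 < s := hs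
    have hpos : (0 : ℝ) < (x : ℝ) ^ 2 + s := by
      have : 0 < s := by linarith
      positivity
    have h1 : HasDerivAt (fun s : ℝ => (x : ℝ) ^ 2 + s) 1 s := by
      simpa using (hasDerivAt_id s).const_add ((x : ℝ) ^ 2)
    refine ((h1.inv hpos.ne').pow k).congr_deriv ?_
    rcases k with _ | k
    · simp
    · simp only [Nat.add_sub_cancel, Pi.inv_apply]
      rw [div_eq_mul_inv, ← inv_pow]
      ring

/-- Differentiating the `k`-th power integral in `t` gives `-k` times the next one, so agreement on
an open half-line passes from each power to the next. -/
theorem integral_inv_sq_add_pow_eq {μ ν : Measure ℝ≥0} [IsProbabilityMeasure μ]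
    [IsProbabilityMeasure ν] {t₀ : ℝ} (ht₀ : 0 < t₀)
    (h : ∀ t, t₀ < t → ∫ x : ℝ≥0, ((x : ℝ) ^ 2 + t)⁻¹ ∂μ = ∫ x : ℝ≥0, ((x : ℝ) ^ 2 + t)⁻¹ ∂ν)
    (k : ℕ) : ∀ t, t₀ < t → ∫ x : ℝ≥0, (((x : ℝ) ^ 2 + t)⁻¹) ^ k ∂μ
      = ∫ x : ℝ≥0, (((x : ℝ) ^ 2 + t)⁻¹) ^ k ∂ν := by
  induction k with
  | zero => intro t _; simp
  | succ k ih =>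
    intro t ht
    rcases Nat.eq_zero_or_pos k with rfl | hk
    · simpa using h t ht
    have h1 := hasDerivAt_integral_inv_sq_add_pow μ (ht₀.trans ht) k
    have h2 := hasDerivAt_integral_inv_sq_add_pow ν (ht₀.trans ht) k
    have h3 := h1.unique (h2.congr_of_eventuallyEq
      (by filter_upwards [Ioi_mem_nhds ht] with s hs using ih s hs))
    rw [integral_const_mul, integral_const_mul] at h3
    exact mul_left_cancel₀ (neg_ne_zero.mpr (Nat.cast_ne_zero.mpr hk.ne')) h3

/-- Fix one `t > t₀`. The function `u = (x² + t)⁻¹` is injective on `[0, ∞)`, so polynomials in `u`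
form a point-separating unital algebra; both measures integrate each power of `u` alike. -/
theorem measure_eq_of_forall_integral_inv_sq_add_eq {μ ν : Measure ℝ≥0} [IsProbabilityMeasure μ]
    [IsProbabilityMeasure ν] {t₀ : ℝ} (ht₀ : 0 < t₀)
    (h : ∀ t, t₀ < t → ∫ x : ℝ≥0, ((x : ℝ) ^ 2 + t)⁻¹ ∂μ = ∫ x : ℝ≥0, ((x : ℝ) ^ 2 + t)⁻¹ ∂ν) :
    μ = ν := by
  have ht₁ : 0 < t₀ + 1 := by linarith
  set u := resolventTest (t₀ + 1) ht₁ with hu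
  let A : StarSubalgebra ℝ (ℝ≥0 →ᵇ ℝ) :=
    { Algebra.adjoin ℝ {u} with
      star_mem' := by
        intro a ha
        have : star a = a := by ext x; simp
        simpa [this] using ha }
  have hA : ∀ g : ℝ≥0 →ᵇ ℝ, g ∈ A ↔ g ∈ Algebra.adjoin ℝ {u} := fun g => Iff.rfl
  refine ext_of_forall_mem_subalgebra_integral_eq_of_polish (𝕜 := ℝ) (A := A) ?_ ?_
  · intro x y hxy
    refine ⟨u, ⟨BoundedContinuousFunction.toContinuousMapStarₐ ℝ u, ?_, rfl⟩, ?_⟩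
    · exact ⟨u, (hA u).2 (Algebra.subset_adjoin rfl), rfl⟩
    · simp only [hu, resolventTest_apply]
      intro h
      have h := inv_injective h
      have h : (x : ℝ) ^ 2 = (y : ℝ) ^ 2 := by linarith
      exact hxy (NNReal.coe_injective ((sq_eq_sq₀ x.2 y.2).1 h))
  · intro g hg
    rw [hA, Algebra.adjoin_singleton_eq_range_aeval] at hg
    obtain ⟨p, rfl⟩ := hg
    have key : ∀ (κ : Measure ℝ≥0) [IsProbabilityMeasure κ], ∫ x, (Polynomial.aeval u p) x ∂κ
        = ∑ k ∈ Finset.range (p.natDegree + 1),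
          p.coeff k * ∫ x : ℝ≥0, (((x : ℝ) ^ 2 + (t₀ + 1))⁻¹) ^ k ∂κ := by
      intro κ _
      simp_rw [← integral_const_mul]
      rw [← integral_finsetSum _ fun k _ => (integrable_inv_sq_add_pow κ ht₁ k).const_mul _]
      congr 1 with x
      rw [Polynomial.aeval_eq_sum_range]
      simp [hu]
    change ∫ x, (Polynomial.aeval u p) x ∂μ = ∫ x, (Polynomial.aeval u p) x ∂ν
    rw [key, key]
    refine Finset.sum_congr rfl fun k _ => ?_
    rw [integral_inv_sq_add_pow_eq ht₀ h k _ (by linarith)]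

/-! ### Tightness and compactness arguments -/

/-- Probability measures on `[0, ∞)` with second moment at most `C`. -/
def secondMomentLE (C : ℝ≥0) : Set (ProbabilityMeasure ℝ≥0) :=
  {μ | ∫⁻ x : ℝ≥0, (x : ℝ≥0∞) ^ 2 ∂(μ : Measure ℝ≥0) ≤ C}

theorem isCompact_closure_secondMomentLE (C : ℝ≥0) : IsCompact (closure (secondMomentLE C)) := by
  apply isCompact_closure_of_isTightMeasureSet
  rw [isTightMeasureSet_iff_exists_isCompact_measure_compl_le]
  intro ε hε
  by_cases hε' : ε = ∞
  · exact ⟨∅, isCompact_empty, fun μ _ => by simp [hε']⟩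
  lift ε to ℝ≥0 using hε'
  have hε : 0 < ε := by exact_mod_cast hε
  -- With `R ≥ 1`, `x > R` implies `x² ≥ R`, so Markov's inequality bounds the mass outside `[0, R]`
  -- by `C / R ≤ ε`.
  obtain ⟨R, hR1, hR⟩ : ∃ R : ℝ≥0, 1 ≤ R ∧ C / ε ≤ R :=
    ⟨max 1 (C / ε), le_max_left _ _, le_max_right _ _⟩
  refine ⟨Set.Icc 0 R, isCompact_Icc, ?_⟩
  rintro _ ⟨μ, hμ, rfl⟩
  have h1 : (μ : Measure ℝ≥0) (Set.Icc 0 R)ᶜ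
      ≤ (μ : Measure ℝ≥0) {x | (R : ℝ≥0∞) ≤ (x : ℝ≥0∞) ^ 2} := by
    apply measure_mono
    intro x hx
    have hx : R < x := by simpa using hx
    have : R ≤ x ^ 2 := by nlinarith
    exact_mod_cast this
  have h2 := mul_meas_ge_le_lintegral (μ := (μ : Measure ℝ≥0))
    (f := fun x : ℝ≥0 => (x : ℝ≥0∞) ^ 2) (by fun_prop) (R : ℝ≥0∞)
  have h3 : (R : ℝ≥0∞) * (μ : Measure ℝ≥0) (Set.Icc 0 R)ᶜ ≤ C :=
    (mul_le_mul_right h1 _).trans (h2.trans hμ)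
  have hR0 : (R : ℝ≥0∞) ≠ 0 := by
    have : 0 < R := by positivity
    exact_mod_cast this.ne'
  calc (μ : Measure ℝ≥0) (Set.Icc 0 R)ᶜ ≤ C / R := by
        rw [ENNReal.le_div_iff_mul_le (Or.inl hR0) (Or.inl (by simp)), mul_comm]; exact h3
    _ ≤ ε := by
        rw [ENNReal.div_le_iff hR0 (by simp)]
        have : C ≤ ε * R := by
          rw [mul_comm]; exact (div_le_iff₀ hε).1 hR
        exact_mod_cast this

/-- The transform of `μ` by the functions `x ↦ (x² + t)⁻¹`, `t > t₀`. -/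
noncomputable def resolventTransform (t₀ : ℝ) (μ : ProbabilityMeasure ℝ≥0) (t : Set.Ioi t₀) : ℝ :=
  ∫ x : ℝ≥0, ((x : ℝ) ^ 2 + t)⁻¹ ∂(μ : Measure ℝ≥0)

theorem continuous_resolventTransform {t₀ : ℝ} (ht₀ : 0 < t₀) :
    Continuous (resolventTransform t₀) :=
  continuous_pi fun t => ProbabilityMeasure.continuous_integral_boundedContinuousFunction
    (resolventTest t (ht₀.trans t.2))

/-- The image of a compact set under the continuous transform is closed in the product topology, so
a point outside it is kept away by finitely many coordinates. -/
theorem exists_finset_resolventTransform_separated {t₀ : ℝ} (ht₀ : 0 < t₀)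
    {A : Set (ProbabilityMeasure ℝ≥0)} (hA : IsCompact A) {h : Set.Ioi t₀ → ℝ}
    (hh : h ∉ resolventTransform t₀ '' A) :
    ∃ (S : Finset (Set.Ioi t₀)) (δ : ℝ), 0 < δ ∧ ∀ ν ∈ A,
      ¬ ∀ t ∈ S, |resolventTransform t₀ ν t - h t| < δ := by
  have hcl := (hA.image (continuous_resolventTransform ht₀)).isClosed
  obtain ⟨S, u, hu, hSu⟩ := isOpen_pi_iff.1 hcl.isOpen_compl h hh
  have : ∀ t : Set.Ioi t₀, ∃ δ : ℝ, 0 < δ ∧ (t ∈ S → Metric.ball (h t) δ ⊆ u t) := by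
    intro t
    by_cases ht : t ∈ S
    · obtain ⟨δ, hδ, hb⟩ := Metric.isOpen_iff.1 (hu t ht).1 _ (hu t ht).2
      exact ⟨δ, hδ, fun _ => hb⟩
    · exact ⟨1, one_pos, fun h => absurd h ht⟩
  choose δ hδ hb using this
  obtain ⟨d, hd, hdS⟩ : ∃ d : ℝ, 0 < d ∧ ∀ t ∈ S, d ≤ δ t := by
    rcases S.eq_empty_or_nonempty with rfl | hne
    · exact ⟨1, one_pos, by simp⟩
    · exact ⟨S.inf' hne δ, (Finset.lt_inf'_iff hne).2 fun t _ => hδ t,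
        fun t ht => Finset.inf'_le _ ht⟩
  refine ⟨S, d, hd, fun ν hν hall => ?_⟩
  refine hSu (a := resolventTransform t₀ ν) (fun t ht => hb t ht ?_) ⟨ν, hν, rfl⟩
  rw [Metric.mem_ball, Real.dist_eq]
  exact (hall t ht).trans_le (hdS t ht)

theorem exists_resolventTransform_eq {t₀ : ℝ} (ht₀ : 0 < t₀) (C : ℝ≥0) (h : Set.Ioi t₀ → ℝ)
    (H : ∀ (S : Finset (Set.Ioi t₀)) (δ : ℝ), 0 < δ → ∃ ν ∈ secondMomentLE C,
      ∀ t ∈ S, |resolventTransform t₀ ν t - h t| < δ) :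
    ∃ μ : ProbabilityMeasure ℝ≥0, resolventTransform t₀ μ = h := by
  by_contra! hcon
  obtain ⟨S, δ, hδ, hS⟩ := exists_finset_resolventTransform_separated ht₀
    (isCompact_closure_secondMomentLE C) (h := h) (by rintro ⟨μ, _, hμ⟩; exact hcon μ hμ)
  obtain ⟨ν, hν, hν'⟩ := H S δ hδ
  exact hS ν (subset_closure hν) hν'

/-- The laws in the compact closure whose integral of `f` is at least `ε` off form a compact set,
and by uniqueness none of them has the transform of `μ`. The resulting `S` and `δ` do not depend on
`ν`, so the statement can be applied to random laws outcome by outcome. -/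
theorem exists_finset_integral_close {t₀ : ℝ} (ht₀ : 0 < t₀) (C : ℝ≥0)
    (μ : ProbabilityMeasure ℝ≥0) (f : ℝ≥0 →ᵇ ℂ) {ε : ℝ} (hε : 0 < ε) :
    ∃ (S : Finset (Set.Ioi t₀)) (δ : ℝ), 0 < δ ∧ ∀ ν ∈ secondMomentLE C,
      (∀ t ∈ S, |resolventTransform t₀ ν t - resolventTransform t₀ μ t| < δ) →
      ‖∫ x, f x ∂(ν : Measure ℝ≥0) - ∫ x, f x ∂(μ : Measure ℝ≥0)‖ < ε := by
  have hcont : Continuous fun ν : ProbabilityMeasure ℝ≥0 => ∫ x, f x ∂(ν : Measure ℝ≥0) := by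
    rw [continuous_iff_continuousAt]
    exact fun ν => (ProbabilityMeasure.tendsto_iff_forall_integral_rclike_tendsto ℂ).1 tendsto_id f
  set B : Set (ProbabilityMeasure ℝ≥0) :=
    {ν | ε ≤ ‖∫ x, f x ∂(ν : Measure ℝ≥0) - ∫ x, f x ∂(μ : Measure ℝ≥0)‖} with hB
  have hBcl : IsClosed B := isClosed_le continuous_const (by fun_prop)
  have hcomp := (isCompact_closure_secondMomentLE C).inter_right hBcl
  obtain ⟨S, δ, hδ, hS⟩ := exists_finset_resolventTransform_separated ht₀ hcomp
    (h := resolventTransform t₀ μ) (by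
      rintro ⟨ν, hν, hνμ⟩
      have : (ν : Measure ℝ≥0) = μ := measure_eq_of_forall_integral_inv_sq_add_eq ht₀
        fun t ht => congrFun hνμ ⟨t, ht⟩
      have h2 : ε ≤ ‖∫ x, f x ∂(ν : Measure ℝ≥0) - ∫ x, f x ∂(μ : Measure ℝ≥0)‖ := hν.2
      rw [this, sub_self, norm_zero] at h2
      linarith)
  refine ⟨S, δ, hδ, fun ν hν hall => ?_⟩
  by_contra! hcon
  exact hS ν ⟨subset_closure hν, hcon⟩ hall

/-! ### Resolvents of Hermitian matrices on the imaginary axis -/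

section ImagResolvent

variable {ι : Type*} [Fintype ι] [DecidableEq ι]

/-- The resolvent `(H - i v)⁻¹` at the point `i v` of the imaginary axis. -/
noncomputable def imagResolvent (H : Matrix ι ι ℂ) (v : ℝ) : Matrix ι ι ℂ :=
  (H - (Complex.I * v) • (1 : Matrix ι ι ℂ))⁻¹

/-- A kernel vector `x` satisfies `H x = i v x`; since the quadratic form of `H` is real, `v ‖x‖² =
0`. -/
theorem isUnit_det_sub_imag {H : Matrix ι ι ℂ} (hH : H.IsHermitian) {v : ℝ} (hv : v ≠ 0) :
    IsUnit (H - (Complex.I * v) • (1 : Matrix ι ι ℂ)).det := by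
  rw [isUnit_iff_ne_zero]
  intro h
  obtain ⟨x, hx, hx0⟩ := Matrix.exists_mulVec_eq_zero_iff.2 h
  rw [Matrix.sub_mulVec, sub_eq_zero, Matrix.smul_mulVec, Matrix.one_mulVec] at hx0
  have h1 := hH.im_star_dotProduct_mulVec_self x
  rw [hx0, dotProduct_smul] at h1
  have h2 : star x ⬝ᵥ x = ((∑ i, ‖x i‖ ^ 2 : ℝ) : ℂ) := by
    simp only [dotProduct, Pi.star_apply, Complex.ofReal_sum]
    refine Finset.sum_congr rfl fun i _ => ?_
    rw [Complex.ofReal_pow]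
    exact Complex.conj_mul' (x i)
  rw [h2] at h1
  have h3 : ∀ S : ℝ, ((Complex.I * v) • (S : ℂ)).im = v * S := fun S => by simp
  have h3 : v * ∑ i, ‖x i‖ ^ 2 = 0 := (h3 _).symm.trans h1
  have h4 : ∑ i, ‖x i‖ ^ 2 = 0 := (mul_eq_zero.1 h3).resolve_left hv
  rw [Finset.sum_eq_zero_iff_of_nonneg (fun i _ => by positivity)] at h4
  exact hx (funext fun i => by simpa using h4 i (Finset.mem_univ i))

theorem sub_imag_mul_imagResolvent {H : Matrix ι ι ℂ} (hH : H.IsHermitian) {v : ℝ} (hv : v ≠ 0) :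
    (H - (Complex.I * v) • (1 : Matrix ι ι ℂ)) * imagResolvent H v = 1 :=
  Matrix.mul_nonsing_inv _ (isUnit_det_sub_imag hH hv)

theorem imagResolvent_mul_sub_imag {H : Matrix ι ι ℂ} (hH : H.IsHermitian) {v : ℝ} (hv : v ≠ 0) :
    imagResolvent H v * (H - (Complex.I * v) • (1 : Matrix ι ι ℂ)) = 1 :=
  Matrix.nonsing_inv_mul _ (isUnit_det_sub_imag hH hv)

theorem imagResolvent_eq_sub {H H₀ : Matrix ι ι ℂ} (hH : H.IsHermitian) (hH₀ : H₀.IsHermitian)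
    {v : ℝ} (hv : v ≠ 0) :
    imagResolvent H v =
      imagResolvent H₀ v - imagResolvent H₀ v * (H - H₀) * imagResolvent H v := by
  have h1 := sub_imag_mul_imagResolvent hH hv
  have h2 := imagResolvent_mul_sub_imag hH₀ hv
  have h3 : H - H₀ = (H - (Complex.I * v) • (1 : Matrix ι ι ℂ))
      - (H₀ - (Complex.I * v) • (1 : Matrix ι ι ℂ)) := by abel
  rw [h3, mul_sub, sub_mul, h2, one_mul, mul_assoc, h1, mul_one]
  abel

theorem conjTranspose_imagResolvent {H : Matrix ι ι ℂ} (hH : H.IsHermitian) (v : ℝ) :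
    (imagResolvent H v).conjTranspose = imagResolvent H (-v) := by
  unfold imagResolvent
  rw [Matrix.conjTranspose_nonsing_inv, Matrix.conjTranspose_sub, hH.eq, Matrix.conjTranspose_smul]
  simp

/-- The Ward identity, source of all the square-sum bounds on rows and columns of the resolvent. -/
theorem imagResolvent_sub_conjTranspose {H : Matrix ι ι ℂ} (hH : H.IsHermitian) {v : ℝ}
    (hv : v ≠ 0) :
    imagResolvent H v - (imagResolvent H v).conjTranspose =
      (2 * Complex.I * v) • (imagResolvent H v * (imagResolvent H v).conjTranspose) := by
  rw [conjTranspose_imagResolvent hH]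
  have h1 := sub_imag_mul_imagResolvent hH (neg_ne_zero.2 hv)
  have h2 := imagResolvent_mul_sub_imag hH hv
  calc imagResolvent H v - imagResolvent H (-v)
      = imagResolvent H v * (H - (Complex.I * ((-v : ℝ) : ℂ)) • (1 : Matrix ι ι ℂ))
          * imagResolvent H (-v)
        - imagResolvent H v * (H - (Complex.I * v) • (1 : Matrix ι ι ℂ))
          * imagResolvent H (-v) := by rw [h2, mul_assoc, h1]; simp
    _ = imagResolvent H v * ((2 * Complex.I * v) • (1 : Matrix ι ι ℂ)) * imagResolvent H (-v) := by
        rw [← sub_mul, ← mul_sub]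
        congr 2
        rw [sub_sub_sub_cancel_left, ← sub_smul]
        congr 1
        push_cast
        ring
    _ = _ := by simp

theorem sum_norm_sq_row_imagResolvent_le {H : Matrix ι ι ℂ} (hH : H.IsHermitian) {v : ℝ}
    (hv : 1 ≤ |v|) (p : ι) : ∑ q, ‖imagResolvent H v p q‖ ^ 2 ≤ 1 := by
  have hv0 : v ≠ 0 := by rintro rfl; norm_num at hv
  have h := congrFun (congrFun (imagResolvent_sub_conjTranspose hH hv0) p) p
  set R := imagResolvent H v
  have h1 : (R * R.conjTranspose) p p = ((∑ q, ‖R p q‖ ^ 2 : ℝ) : ℂ) := by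
    rw [Matrix.mul_apply, Complex.ofReal_sum]
    refine Finset.sum_congr rfl fun q _ => ?_
    rw [Complex.ofReal_pow]
    exact Complex.mul_conj' (R p q)
  rw [Matrix.smul_apply, h1] at h
  have h2 := congrArg Complex.im h
  have h3 : 2 * (R p p).im = 2 * (v * ∑ q, ‖R p q‖ ^ 2) := by
    simp only [Matrix.sub_apply, Matrix.conjTranspose_apply, Complex.sub_im, smul_eq_mul,
      Complex.im_mul_ofReal] at h2
    simp at h2
    linarith
  set S := ∑ q, ‖R p q‖ ^ 2
  have hS0 : 0 ≤ S := Finset.sum_nonneg fun q _ => by positivity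
  have h4 : ‖R p p‖ ^ 2 ≤ S :=
    Finset.single_le_sum (f := fun q => ‖R p q‖ ^ 2) (fun q _ => by positivity) (Finset.mem_univ p)
  -- The Ward identity reads `Im R_pp = v S` on the diagonal. Together with `‖R_pp‖² ≤ S` and `|v| ≥
  -- 1` this gives `S ≤ ‖R_pp‖ ≤ 1`.
  have h5 : S ≤ ‖R p p‖ := by
    have h6 := Complex.abs_im_le_norm (R p p)
    have h7 : (R p p).im = v * S := by linarith
    rw [h7, abs_mul, abs_of_nonneg hS0] at h6
    nlinarith
  nlinarith [norm_nonneg (R p p)]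

theorem sum_norm_sq_col_imagResolvent_le {H : Matrix ι ι ℂ} (hH : H.IsHermitian) {v : ℝ}
    (hv : 1 ≤ |v|) (q : ι) : ∑ p, ‖imagResolvent H v p q‖ ^ 2 ≤ 1 := by
  have h := sum_norm_sq_row_imagResolvent_le hH (v := -v) (by rwa [abs_neg]) q
  rw [← conjTranspose_imagResolvent hH] at h
  simpa using h

theorem norm_imagResolvent_apply_le {H : Matrix ι ι ℂ} (hH : H.IsHermitian) {v : ℝ}
    (hv : 1 ≤ |v|) (p q : ι) : ‖imagResolvent H v p q‖ ≤ 1 := by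
  have h := sum_norm_sq_row_imagResolvent_le hH hv p
  have h2 : ‖imagResolvent H v p q‖ ^ 2 ≤ ∑ q, ‖imagResolvent H v p q‖ ^ 2 :=
    Finset.single_le_sum (f := fun q => ‖imagResolvent H v p q‖ ^ 2)
      (fun q _ => by positivity) (Finset.mem_univ q)
  nlinarith [norm_nonneg (imagResolvent H v p q)]

end ImagResolvent

theorem sum_mul_le_one_of_sum_sq_le_one {κ : Type*} (s : Finset κ) (f g : κ → ℝ)
    (hf : ∑ k ∈ s, f k ^ 2 ≤ 1) (hg : ∑ k ∈ s, g k ^ 2 ≤ 1) : ∑ k ∈ s, f k * g k ≤ 1 := by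
  have h : ∑ k ∈ s, f k * g k ≤ ∑ k ∈ s, (f k ^ 2 + g k ^ 2) / 2 :=
    Finset.sum_le_sum fun k _ => by nlinarith [sq_nonneg (f k - g k)]
  rw [← Finset.sum_div, Finset.sum_add_distrib] at h
  linarith

theorem sum_prod_snd_le {κ τ : Type*} [Fintype κ] [Fintype τ] (f : κ × τ → ℝ) (hf : ∀ p, 0 ≤ f p)
    (a : κ) : ∑ k, f (a, k) ≤ ∑ p, f p := by
  rw [Fintype.sum_prod_type]
  exact Finset.single_le_sum (f := fun a => ∑ k, f (a, k))
    (fun a _ => Finset.sum_nonneg fun k _ => hf _) (Finset.mem_univ a)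

theorem Matrix.mul_single_mul_apply {ι : Type*} [Fintype ι] [DecidableEq ι]
    (A B : Matrix ι ι ℂ) (u w p q : ι) (c : ℂ) :
    (A * Matrix.single u w c * B) p q = c * (A p u * B w q) := by
  rw [Matrix.mul_apply, Finset.sum_eq_single w]
  · rw [Matrix.mul_single_apply_same]
    ring
  · intro b _ hb
    rw [Matrix.mul_single_apply_of_ne _ _ _ _ _ hb, zero_mul]
  · simp

/-! ### Hermitization and deletion of one pair of entries -/

section Hermitization

variable {n : ℕ}

/-- The Hermitian block matrix with off-diagonal blocks `W` and `Wᴴ`. -/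
def hermitization (W : Matrix (Fin n) (Fin n) ℂ) : Matrix (Bool × Fin n) (Bool × Fin n) ℂ :=
  fun p q => if q.1 = p.1 then 0 else if p.1 then conj (W q.2 p.2) else W p.2 q.2

theorem isHermitian_hermitization (W : Matrix (Fin n) (Fin n) ℂ) :
    (hermitization W).IsHermitian := by
  ext ⟨a, i⟩ ⟨b, j⟩
  cases a <;> cases b <;> simp [hermitization, Matrix.conjTranspose_apply]

/-- `A` or its transpose. -/
def orient (a : Bool) (A : Matrix (Fin n) (Fin n) ℝ) (i j : Fin n) : ℝ := if a then A j i else A i j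

/-- `z` or its conjugate. -/
def orientShift (a : Bool) (z : ℂ) : ℂ := if a then conj z else z

theorem norm_orientShift (a : Bool) (z : ℂ) : ‖orientShift a z‖ = ‖z‖ := by
  cases a <;> simp [orientShift]

/-- The inverse square root of the dimension. -/
noncomputable def invSqrt (n : ℕ) : ℝ := (Real.sqrt n)⁻¹

/-- The Hermitization of `n^{-1/2} A - z`. -/
noncomputable def shiftedHerm (A : Matrix (Fin n) (Fin n) ℝ) (z : ℂ) :
    Matrix (Bool × Fin n) (Bool × Fin n) ℂ := hermitization (shiftedMatrix A z)

theorem shiftedHerm_apply (A : Matrix (Fin n) (Fin n) ℝ) (z : ℂ) (p q : Bool × Fin n) :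
    shiftedHerm A z p q = if q.1 = p.1 then 0 else
      (invSqrt n : ℂ) * orient p.1 A p.2 q.2 - if p.2 = q.2 then orientShift p.1 z else 0 := by
  obtain ⟨a, i⟩ := p
  obtain ⟨b, j⟩ := q
  by_cases hij : i = j
  · cases a <;> cases b <;>
      simp [shiftedHerm, hermitization, shiftedMatrix, orient, orientShift, invSqrt, hij]
  · cases a <;> cases b <;>
      simp [shiftedHerm, hermitization, shiftedMatrix, orient, invSqrt, hij,
        Ne.symm hij]

theorem isHermitian_shiftedHerm (A : Matrix (Fin n) (Fin n) ℝ) (z : ℂ) :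
    (shiftedHerm A z).IsHermitian := isHermitian_hermitization _

/-- The resolvent of the Hermitization of `n^{-1/2} A - z`. -/
noncomputable def hermResolvent (z : ℂ) (v : ℝ) (A : Matrix (Fin n) (Fin n) ℝ) :
    Matrix (Bool × Fin n) (Bool × Fin n) ℂ := imagResolvent (shiftedHerm A z) v

/-- The two products of resolvent entries that come from perturbing the `(i, j)` entry. -/
def pairTerm (a : Bool) (i j : Fin n) (R S : Matrix (Bool × Fin n) (Bool × Fin n) ℂ)
    (p q : Bool × Fin n) : ℂ :=
  R p (a, i) * S (!a, j) q + R p (!a, j) * S (a, i) q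

/-- `A` with its entries at `(i, j)` and `(j, i)` replaced by zero. -/
def zeroPair (i j : Fin n) (A : Matrix (Fin n) (Fin n) ℝ) : Matrix (Fin n) (Fin n) ℝ :=
  fun k l => if (i = k ∧ j = l) ∨ (j = k ∧ i = l) then 0 else A k l

/-- Each of the two deleted entries sits in both off-diagonal blocks, hence four matrix units. The
flag `a` merely relabels them, so that `orient a A i j` can later be matched with the row block `a`
of the defect. -/
theorem shiftedHerm_sub_zeroPair (A : Matrix (Fin n) (Fin n) ℝ) (z : ℂ) (a : Bool) {i j : Fin n}
    (hij : i ≠ j) :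
    shiftedHerm A z - shiftedHerm (zeroPair i j A) z =
      Matrix.single (a, i) (!a, j) ((invSqrt n : ℂ) * orient a A i j) +
      Matrix.single (!a, j) (a, i) ((invSqrt n : ℂ) * orient a A i j) +
      (Matrix.single (a, j) (!a, i) ((invSqrt n : ℂ) * orient a A j i) +
      Matrix.single (!a, i) (a, j) ((invSqrt n : ℂ) * orient a A j i)) := by
  have h : ∀ (b : Bool) (k l : Fin n), (orient b A k l : ℂ) - orient b (zeroPair i j A) k l =
      if (i = k ∧ j = l) ∨ (j = k ∧ i = l) then (orient b A k l : ℂ) else 0 := by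
    intro b k l
    cases b <;> simp only [orient, zeroPair] <;> split_ifs <;> first | (exfalso; tauto) | simp
  ext ⟨b, k⟩ ⟨c, l⟩
  rw [Matrix.sub_apply, shiftedHerm_apply, shiftedHerm_apply]
  have h' := h b k l
  simp only [Matrix.add_apply, Matrix.single_apply, Prod.mk.injEq]
  by_cases hcb : c = b
  · subst hcb
    have h1 : ¬ (a = c ∧ (!a) = c) := by cases a <;> cases c <;> simp
    have h2 : ¬ ((!a) = c ∧ a = c) := by cases a <;> cases c <;> simp
    rw [if_pos rfl, if_pos rfl, if_neg (by tauto), if_neg (by tauto), if_neg (by tauto),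
      if_neg (by tauto)]
    simp
  · rw [if_neg hcb, if_neg hcb, sub_sub_sub_cancel_right, ← mul_sub, h']
    have hc : c = !b := by cases b <;> cases c <;> simp_all
    subst hc
    by_cases hab : a = b
    · subst hab
      by_cases hki : i = k <;> by_cases hkj : j = k <;> by_cases hli : i = l <;>
        by_cases hlj : j = l <;> simp_all
    · have ha : a = !b := by cases b <;> cases a <;> simp_all
      subst ha
      by_cases hki : i = k <;> by_cases hkj : j = k <;> by_cases hli : i = l <;>
        by_cases hlj : j = l <;> cases b <;> simp_all [orient]

/-- The second resolvent identity, with the deleted resolvent on the left and the full one on the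
right. Replacing the right factor by the deleted resolvent gives the first-order expansion. -/
theorem hermResolvent_eq_zeroPair (A : Matrix (Fin n) (Fin n) ℝ) (z : ℂ) {v : ℝ} (hv : v ≠ 0)
    (a : Bool) {i j : Fin n} (hij : i ≠ j) (p q : Bool × Fin n) :
    hermResolvent z v A p q = hermResolvent z v (zeroPair i j A) p q -
      invSqrt n * (orient a A i j * pairTerm a i j (hermResolvent z v (zeroPair i j A))
          (hermResolvent z v A) p q +
        orient a A j i * pairTerm a j i (hermResolvent z v (zeroPair i j A))
          (hermResolvent z v A) p q) := by
  have h := congrFun (congrFun (imagResolvent_eq_sub (isHermitian_shiftedHerm A z)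
    (isHermitian_shiftedHerm (zeroPair i j A) z) hv) p) q
  rw [shiftedHerm_sub_zeroPair A z a hij] at h
  simp only [mul_add, add_mul, Matrix.sub_apply, Matrix.add_apply,
    Matrix.mul_single_mul_apply] at h
  unfold hermResolvent pairTerm
  refine h.trans ?_
  ring

end Hermitization

/-! ### The self-consistent equation and its stability under deletion -/

section Defect

variable {n : ℕ}

/-- The normalized traces of the four blocks of the resolvent. -/
noncomputable def blockTrace (z : ℂ) (v : ℝ) (A : Matrix (Fin n) (Fin n) ℝ) (a b : Bool) : ℂ :=
  (n : ℂ)⁻¹ * ∑ k, hermResolvent z v A (a, k) (b, k)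

/-- The defect in the self-consistent equation for the block traces. -/
noncomputable def dysonDefect (ρ : ℝ) (z : ℂ) (v : ℝ) (g : Bool → Bool → ℂ) (a b : Bool) : ℂ :=
  (if a = b then 1 else 0) + orientShift a z * g (!a) b + Complex.I * v * g a b
    + g (!a) (!a) * g a b + ρ * (g (!a) a * g (!a) b)

theorem norm_mul_sub_mul_le {a b c d : ℂ} {α β ε η : ℝ} (hb : ‖b‖ ≤ β) (hc : ‖c‖ ≤ α)
    (h1 : ‖a - c‖ ≤ ε) (h2 : ‖b - d‖ ≤ η) :
    ‖a * b - c * d‖ ≤ ε * β + α * η := by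
  have : a * b - c * d = (a - c) * b + c * (b - d) := by ring
  rw [this]
  refine (norm_add_le _ _).trans (add_le_add ?_ ?_)
  · rw [norm_mul]
    exact mul_le_mul h1 hb (norm_nonneg _) ((norm_nonneg _).trans h1)
  · rw [norm_mul]
    exact mul_le_mul hc h2 (norm_nonneg _) ((norm_nonneg _).trans hc)

theorem norm_dysonDefect_le {ρ : ℝ} (hρ : |ρ| ≤ 1) (z : ℂ) {v : ℝ} (hv : 0 ≤ v)
    {g : Bool → Bool → ℂ} (hg : ∀ a b, ‖g a b‖ ≤ 1) (a b : Bool) :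
    ‖dysonDefect ρ z v g a b‖ ≤ ‖z‖ + v + 4 := by
  have h0 : ‖(if a = b then (1 : ℂ) else 0)‖ ≤ 1 := by split_ifs <;> simp
  have h1 : ‖orientShift a z * g (!a) b‖ ≤ ‖z‖ := by
    rw [norm_mul, norm_orientShift]
    exact mul_le_of_le_one_right (norm_nonneg _) (hg _ _)
  have h2 : ‖Complex.I * v * g a b‖ ≤ v := by
    simp only [norm_mul, Complex.norm_I, one_mul, Complex.norm_real, Real.norm_of_nonneg hv]
    exact mul_le_of_le_one_right hv (hg _ _)
  have hgg : ∀ a b c d, ‖g a b * g c d‖ ≤ 1 := fun a b c d => by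
    rw [norm_mul]
    exact mul_le_one₀ (hg _ _) (norm_nonneg _) (hg _ _)
  have h3 := hgg (!a) (!a) a b
  have h4 : ‖(ρ : ℂ) * (g (!a) a * g (!a) b)‖ ≤ 1 := by
    rw [norm_mul, Complex.norm_real]
    exact mul_le_one₀ hρ (norm_nonneg _) (hgg _ _ _ _)
  unfold dysonDefect
  linarith [norm_add₄_le (a := (if a = b then (1 : ℂ) else 0)) (b := orientShift a z * g (!a) b)
      (c := Complex.I * v * g a b) (d := g (!a) (!a) * g a b),
    norm_add_le ((if a = b then (1 : ℂ) else 0) + orientShift a z * g (!a) b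
      + Complex.I * v * g a b + g (!a) (!a) * g a b) (ρ * (g (!a) a * g (!a) b))]

/-- On the unit ball the two linear terms have Lipschitz constants `‖z‖` and `v`, and each quadratic
term has constant `2`. The case `v = 0` is the one used for the contraction. -/
theorem norm_dysonDefect_sub_le {ρ : ℝ} (hρ : |ρ| ≤ 1) (z : ℂ) {v : ℝ} (hv : 0 ≤ v)
    {g g' : Bool → Bool → ℂ} (hg : ∀ a b, ‖g a b‖ ≤ 1) (hg' : ∀ a b, ‖g' a b‖ ≤ 1) {ε : ℝ}
    (h : ∀ a b, ‖g a b - g' a b‖ ≤ ε) (a b : Bool) :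
    ‖dysonDefect ρ z v g a b - dysonDefect ρ z v g' a b‖ ≤ (‖z‖ + v + 4) * ε := by
  have h1 : ‖orientShift a z * (g (!a) b - g' (!a) b)‖ ≤ ‖z‖ * ε := by
    rw [norm_mul, norm_orientShift]
    exact mul_le_mul_of_nonneg_left (h _ _) (norm_nonneg _)
  have h2 : ‖Complex.I * v * (g a b - g' a b)‖ ≤ v * ε := by
    simp only [norm_mul, Complex.norm_I, one_mul, Complex.norm_real, Real.norm_of_nonneg hv]
    exact mul_le_mul_of_nonneg_left (h _ _) hv
  have hgg : ∀ a b c d, ‖g a b * g c d - g' a b * g' c d‖ ≤ 2 * ε := fun a b c d => by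
    linarith [norm_mul_sub_mul_le (hg c d) (hg' a b) (h a b) (h c d)]
  have h3 := hgg (!a) (!a) a b
  have h4 : ‖(ρ : ℂ) * (g (!a) a * g (!a) b - g' (!a) a * g' (!a) b)‖ ≤ 2 * ε := by
    rw [norm_mul, Complex.norm_real]
    exact (mul_le_of_le_one_left (norm_nonneg _) hρ).trans (hgg _ _ _ _)
  have : dysonDefect ρ z v g a b - dysonDefect ρ z v g' a b =
      orientShift a z * (g (!a) b - g' (!a) b) + Complex.I * v * (g a b - g' a b)
      + (g (!a) (!a) * g a b - g' (!a) (!a) * g' a b)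
      + ρ * (g (!a) a * g (!a) b - g' (!a) a * g' (!a) b) := by
    unfold dysonDefect
    ring
  rw [this]
  refine norm_add₄_le.trans ?_
  linarith

theorem invSqrt_nonneg (n : ℕ) : 0 ≤ invSqrt n := by unfold invSqrt; positivity

theorem invSqrt_le_one (n : ℕ) : invSqrt n ≤ 1 := by
  rcases Nat.eq_zero_or_pos n with rfl | hn
  · simp [invSqrt]
  · exact inv_le_one_of_one_le₀ (Real.one_le_sqrt.2 (by exact_mod_cast hn))

theorem invSqrt_sq (n : ℕ) : invSqrt n ^ 2 = (n : ℝ)⁻¹ := by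
  rw [invSqrt, inv_pow, Real.sq_sqrt (Nat.cast_nonneg n)]

variable {z : ℂ} {v : ℝ}

theorem norm_hermResolvent_apply_le (hv : 1 ≤ v) (A : Matrix (Fin n) (Fin n) ℝ)
    (p q : Bool × Fin n) : ‖hermResolvent z v A p q‖ ≤ 1 :=
  norm_imagResolvent_apply_le (isHermitian_shiftedHerm A z) (hv.trans (le_abs_self v)) p q

theorem sum_norm_sq_row_le (hv : 1 ≤ v) (A : Matrix (Fin n) (Fin n) ℝ)
    (p : Bool × Fin n) (b : Bool) : ∑ k, ‖hermResolvent z v A p (b, k)‖ ^ 2 ≤ 1 :=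
  (sum_prod_snd_le (fun q => ‖hermResolvent z v A p q‖ ^ 2) (fun _ => by positivity) b).trans
    (sum_norm_sq_row_imagResolvent_le (isHermitian_shiftedHerm A z) (hv.trans (le_abs_self v)) p)

theorem sum_norm_sq_col_le (hv : 1 ≤ v) (A : Matrix (Fin n) (Fin n) ℝ)
    (q : Bool × Fin n) (a : Bool) : ∑ k, ‖hermResolvent z v A (a, k) q‖ ^ 2 ≤ 1 :=
  (sum_prod_snd_le (fun p => ‖hermResolvent z v A p q‖ ^ 2) (fun _ => by positivity) a).trans
    (sum_norm_sq_col_imagResolvent_le (isHermitian_shiftedHerm A z) (hv.trans (le_abs_self v)) q)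

theorem norm_blockTrace_le (hv : 1 ≤ v) (A : Matrix (Fin n) (Fin n) ℝ) (a b : Bool) :
    ‖blockTrace z v A a b‖ ≤ 1 := by
  rw [blockTrace, norm_mul, norm_inv, Complex.norm_natCast]
  have : ‖∑ k, hermResolvent z v A (a, k) (b, k)‖ ≤ n := by
    refine (norm_sum_le_of_le _ fun k _ => norm_hermResolvent_apply_le hv A _ _).trans ?_
    simp
  exact inv_mul_le_one_of_le₀ this (Nat.cast_nonneg n)

theorem norm_pairTerm_le {i j : Fin n} {R S : Matrix (Bool × Fin n) (Bool × Fin n) ℂ}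
    (hR : ∀ p q, ‖R p q‖ ≤ 1) (hS : ∀ p q, ‖S p q‖ ≤ 1) (a : Bool) (p q : Bool × Fin n) :
    ‖pairTerm a i j R S p q‖ ≤ 2 := by
  have h : ∀ p q p' q', ‖R p q * S p' q'‖ ≤ 1 := fun p q p' q' => by
    rw [norm_mul]; exact mul_le_one₀ (hR _ _) (norm_nonneg _) (hS _ _)
  exact (norm_add_le _ _).trans (by linarith [h p (a, i) (!a, j) q, h p (!a, j) (a, i) q])

theorem norm_pairTerm_sub_le {i j : Fin n} {R S R' S' : Matrix (Bool × Fin n) (Bool × Fin n) ℂ}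
    (hR' : ∀ p q, ‖R' p q‖ ≤ 1) (hS : ∀ p q, ‖S p q‖ ≤ 1)
    {ε η : ℝ} (h1 : ∀ p q, ‖R p q - R' p q‖ ≤ ε) (h2 : ∀ p q, ‖S p q - S' p q‖ ≤ η)
    (a : Bool) (p q : Bool × Fin n) :
    ‖pairTerm a i j R S p q - pairTerm a i j R' S' p q‖ ≤ 2 * (ε + η) := by
  have e1 := norm_mul_sub_mul_le (hS (!a, j) q) (hR' p (a, i)) (h1 p (a, i)) (h2 (!a, j) q)
  have e2 := norm_mul_sub_mul_le (hS (a, i) q) (hR' p (!a, j)) (h1 p (!a, j)) (h2 (a, i) q)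
  have : pairTerm a i j R S p q - pairTerm a i j R' S' p q =
      (R p (a, i) * S (!a, j) q - R' p (a, i) * S' (!a, j) q) +
      (R p (!a, j) * S (a, i) q - R' p (!a, j) * S' (a, i) q) := by
    unfold pairTerm; ring
  rw [this]
  exact (norm_add_le _ _).trans (by linarith)

/-- The size of the pair of entries at `(i, j)` and `(j, i)`. -/
def pairSize (A : Matrix (Fin n) (Fin n) ℝ) (i j : Fin n) : ℝ := |A i j| + |A j i|

theorem pairSize_nonneg (A : Matrix (Fin n) (Fin n) ℝ) (i j : Fin n) : 0 ≤ pairSize A i j := by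
  unfold pairSize; positivity

theorem abs_orient_add_abs_orient (a : Bool) (A : Matrix (Fin n) (Fin n) ℝ) (i j : Fin n) :
    |orient a A i j| + |orient a A j i| = pairSize A i j := by
  cases a <;> simp [orient, pairSize, add_comm]

theorem norm_orient_combination_le (a : Bool) (A : Matrix (Fin n) (Fin n) ℝ) (i j : Fin n)
    {t t' : ℂ} {c : ℝ} (ht : ‖t‖ ≤ c) (ht' : ‖t'‖ ≤ c) :
    ‖invSqrt n * (orient a A i j * t + orient a A j i * t')‖ ≤
      invSqrt n * (c * pairSize A i j) := by
  rw [norm_mul, Complex.norm_real, Real.norm_of_nonneg (invSqrt_nonneg n),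
    ← abs_orient_add_abs_orient a]
  refine mul_le_mul_of_nonneg_left ((norm_add_le _ _).trans ?_) (invSqrt_nonneg n)
  simp only [norm_mul, Complex.norm_real, Real.norm_eq_abs]
  nlinarith [abs_nonneg (orient a A i j), abs_nonneg (orient a A j i)]

theorem norm_hermResolvent_sub_zeroPair_le (hv : 1 ≤ v) (A : Matrix (Fin n) (Fin n) ℝ)
    {i j : Fin n} (hij : i ≠ j) (p q : Bool × Fin n) :
    ‖hermResolvent z v A p q - hermResolvent z v (zeroPair i j A) p q‖ ≤
      2 * (invSqrt n * pairSize A i j) := by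
  rw [hermResolvent_eq_zeroPair A z (by linarith : v ≠ 0) false hij, sub_right_comm, sub_self,
    zero_sub, norm_neg]
  refine (norm_orient_combination_le false A i j (c := 2) ?_ ?_).trans (by linarith)
  · exact norm_pairTerm_le (norm_hermResolvent_apply_le hv _) (norm_hermResolvent_apply_le hv _) ..
  · exact norm_pairTerm_le (norm_hermResolvent_apply_le hv _) (norm_hermResolvent_apply_le hv _) ..

/-- Columns and rows of the resolvents have square sums at most one, so Cauchy-Schwarz bounds the
sum over `k` independently of `n`. This makes the block traces move by `n^{-3/2}` only when a pair
is deleted. -/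
theorem norm_sum_pairTerm_le (hv : 1 ≤ v) (A A' : Matrix (Fin n) (Fin n) ℝ) (c a b : Bool)
    (i j : Fin n) : ‖∑ k, pairTerm c i j (hermResolvent z v A) (hermResolvent z v A')
      (a, k) (b, k)‖ ≤ 2 := by
  have h : ∀ p q, ‖∑ k, hermResolvent z v A (a, k) p * hermResolvent z v A' q (b, k)‖ ≤ 1 := by
    intro p q
    refine (norm_sum_le _ _).trans ?_
    simp only [norm_mul]
    exact sum_mul_le_one_of_sum_sq_le_one _ _ _ (sum_norm_sq_col_le hv A p a)
      (sum_norm_sq_row_le hv A' q b)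
  simp only [pairTerm, Finset.sum_add_distrib]
  exact (norm_add_le _ _).trans (by linarith [h (c, i) (!c, j), h (!c, j) (c, i)])

theorem norm_blockTrace_sub_zeroPair_le (hv : 1 ≤ v) (A : Matrix (Fin n) (Fin n) ℝ)
    {i j : Fin n} (hij : i ≠ j) (a b : Bool) :
    ‖blockTrace z v A a b - blockTrace z v (zeroPair i j A) a b‖ ≤
      2 * (invSqrt n ^ 3 * pairSize A i j) := by
  have : blockTrace z v A a b - blockTrace z v (zeroPair i j A) a b =
      -((n : ℂ)⁻¹ * (invSqrt n * (orient false A i j *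
        ∑ k, pairTerm false i j (hermResolvent z v (zeroPair i j A)) (hermResolvent z v A)
          (a, k) (b, k) +
        orient false A j i *
        ∑ k, pairTerm false j i (hermResolvent z v (zeroPair i j A)) (hermResolvent z v A)
          (a, k) (b, k)))) := by
    rw [blockTrace, blockTrace, ← mul_sub, ← Finset.sum_sub_distrib, ← mul_neg]
    congr 1
    rw [Finset.mul_sum, Finset.mul_sum, ← Finset.sum_add_distrib, Finset.mul_sum,
      ← Finset.sum_neg_distrib]
    refine Finset.sum_congr rfl fun k _ => ?_
    rw [hermResolvent_eq_zeroPair A z (by linarith : v ≠ 0) false hij]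
    ring
  rw [this, norm_neg, norm_mul, norm_inv, Complex.norm_natCast, ← invSqrt_sq]
  have h := norm_orient_combination_le false A i j
    (norm_sum_pairTerm_le (z := z) hv (zeroPair i j A) A false a b i j)
    (norm_sum_pairTerm_le (z := z) hv (zeroPair i j A) A false a b j i)
  calc _ ≤ invSqrt n ^ 2 * (invSqrt n * (2 * pairSize A i j)) := by gcongr
    _ = _ := by ring

/-- The conjugate of the defect at the block traces of `A`. -/
noncomputable def conjDefect (ρ : ℝ) (z : ℂ) (v : ℝ) (a b : Bool)
    (A : Matrix (Fin n) (Fin n) ℝ) : ℂ := conj (dysonDefect ρ z v (blockTrace z v A) a b)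

theorem norm_conjDefect_le {ρ : ℝ} (hρ : |ρ| ≤ 1) (hv : 1 ≤ v) (a b : Bool)
    (A : Matrix (Fin n) (Fin n) ℝ) : ‖conjDefect ρ z v a b A‖ ≤ ‖z‖ + v + 4 := by
  rw [conjDefect, RCLike.norm_conj]
  exact norm_dysonDefect_le hρ z (by linarith) (norm_blockTrace_le hv A) a b

theorem norm_conjDefect_sub_zeroPair_le {ρ : ℝ} (hρ : |ρ| ≤ 1) (hv : 1 ≤ v) (a b : Bool)
    (A : Matrix (Fin n) (Fin n) ℝ) {i j : Fin n} (hij : i ≠ j) :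
    ‖conjDefect ρ z v a b A - conjDefect ρ z v a b (zeroPair i j A)‖ ≤
      (‖z‖ + v + 4) * (2 * (invSqrt n ^ 3 * pairSize A i j)) := by
  rw [conjDefect, conjDefect, ← map_sub, RCLike.norm_conj]
  exact norm_dysonDefect_sub_le hρ z (by linarith) (norm_blockTrace_le hv A)
    (norm_blockTrace_le hv _) (norm_blockTrace_sub_zeroPair_le hv A hij) a b

/-- The resolvent is expanded to first order in the pair. The test factor needs order zero only,
since its change is already `O(n^{-3/2})`. The error has size `n⁻¹` times a cubic polynomial in the
pair size, which the fourth moment controls. -/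
theorem norm_entry_mul_conjDefect_sub_le {ρ : ℝ} (hρ : |ρ| ≤ 1) (hv : 1 ≤ v) (c a b : Bool)
    (A : Matrix (Fin n) (Fin n) ℝ) {i j : Fin n} (hij : i ≠ j) (p q : Bool × Fin n) :
    ‖orient c A i j * (hermResolvent z v A p q * conjDefect ρ z v a b A -
      (hermResolvent z v (zeroPair i j A) p q - invSqrt n *
        (orient c A i j * pairTerm c i j (hermResolvent z v (zeroPair i j A))
          (hermResolvent z v (zeroPair i j A)) p q +
        orient c A j i * pairTerm c j i (hermResolvent z v (zeroPair i j A))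
          (hermResolvent z v (zeroPair i j A)) p q)) * conjDefect ρ z v a b (zeroPair i j A))‖ ≤
      6 * (‖z‖ + v + 4) * invSqrt n ^ 2 * (1 + pairSize A i j ^ 4) := by
  set L := ‖z‖ + v + 4
  set s := invSqrt n
  set r := pairSize A i j
  set R := hermResolvent z v A
  set S := hermResolvent z v (zeroPair i j A)
  set d := conjDefect ρ z v a b A
  set e := conjDefect ρ z v a b (zeroPair i j A)
  have hs0 : 0 ≤ s := invSqrt_nonneg n
  have hs1 : s ≤ 1 := invSqrt_le_one n
  have hr : 0 ≤ r := pairSize_nonneg A i j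
  have hL : 0 ≤ L := by positivity
  have hR : ∀ p q, ‖R p q‖ ≤ 1 := norm_hermResolvent_apply_le hv A
  have hS : ∀ p q, ‖S p q‖ ≤ 1 := norm_hermResolvent_apply_le hv _
  have hRS : ∀ p q, ‖R p q - S p q‖ ≤ 2 * (s * r) := norm_hermResolvent_sub_zeroPair_le hv A hij
  have hx : |orient c A i j| ≤ r := by
    rw [show r = _ from (abs_orient_add_abs_orient c A i j).symm]
    linarith [abs_nonneg (orient c A j i)]
  have key : R p q - (S p q - s * (orient c A i j * pairTerm c i j S S p q +
      orient c A j i * pairTerm c j i S S p q)) =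
      -(s * (orient c A i j * (pairTerm c i j S R p q - pairTerm c i j S S p q) +
      orient c A j i * (pairTerm c j i S R p q - pairTerm c j i S S p q))) := by
    have := hermResolvent_eq_zeroPair A z (by linarith : v ≠ 0) c hij p q
    simp only [R, S, s, this]
    ring
  have hSS : ∀ p q, ‖S p q - S p q‖ ≤ 0 := by simp
  have h1 := norm_orient_combination_le c A i j
    (norm_pairTerm_sub_le (i := i) (j := j) hS hR hSS hRS c p q)
    (norm_pairTerm_sub_le (i := j) (j := i) hS hR hSS hRS c p q)
  rw [← norm_neg, ← key] at h1
  have h2 : ‖d - e‖ ≤ L * (2 * (s ^ 3 * r)) := norm_conjDefect_sub_zeroPair_le hρ hv a b A hij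
  have h3 : ‖e‖ ≤ L := norm_conjDefect_le hρ hv a b _
  have h4 : ∀ w : ℂ, R p q * d - w * e = R p q * (d - e) + (R p q - w) * e := fun w => by ring
  rw [h4, norm_mul, Complex.norm_real, Real.norm_eq_abs]
  have hs3 : s ^ 3 ≤ s ^ 2 := pow_le_pow_of_le_one hs0 hs1 (by norm_num)
  have h5 : ‖R p q * (d - e) + (R p q - (S p q - s * (orient c A i j * pairTerm c i j S S p q +
      orient c A j i * pairTerm c j i S S p q))) * e‖ ≤
      2 * L * s ^ 2 * r + 4 * L * s ^ 2 * r ^ 2 := by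
    refine (norm_add_le _ _).trans (add_le_add ?_ ?_)
    · rw [norm_mul]
      calc _ ≤ 1 * (L * (2 * (s ^ 3 * r))) := by
            gcongr
            exact hR p q
        _ ≤ 1 * (L * (2 * (s ^ 2 * r))) := by gcongr
        _ = _ := by ring
    · rw [norm_mul]
      calc _ ≤ (s * (2 * (0 + 2 * (s * r)) * r)) * L := by
            gcongr
        _ = _ := by ring
  calc |orient c A i j| * _ ≤ r * (2 * L * s ^ 2 * r + 4 * L * s ^ 2 * r ^ 2) := by gcongr
    _ = L * s ^ 2 * (2 * r ^ 2 + 4 * r ^ 3) := by ring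
    _ ≤ L * s ^ 2 * (6 * (1 + r ^ 4)) := by
        gcongr
        nlinarith [sq_nonneg (r ^ 2 - 1), sq_nonneg (r - 1), sq_nonneg (r ^ 2 - r)]
    _ = _ := by ring

/-- Allows the return from the deleted matrix to the full one once independence has been used; the
pair terms carry a further factor `n^{-1/2}`, so this error also becomes `O(n⁻¹)`. -/
theorem norm_pairTerm_mul_conjDefect_sub_le {ρ : ℝ} (hρ : |ρ| ≤ 1) (hv : 1 ≤ v) (c a b : Bool)
    (A : Matrix (Fin n) (Fin n) ℝ) {i j : Fin n} (hij : i ≠ j) (k l : Fin n) (p q : Bool × Fin n) :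
    ‖pairTerm c k l (hermResolvent z v (zeroPair i j A)) (hermResolvent z v (zeroPair i j A)) p q *
        conjDefect ρ z v a b (zeroPair i j A) -
      pairTerm c k l (hermResolvent z v A) (hermResolvent z v A) p q * conjDefect ρ z v a b A‖ ≤
      12 * (‖z‖ + v + 4) * invSqrt n * (1 + pairSize A i j ^ 4) := by
  have hR := norm_hermResolvent_apply_le (z := z) hv A
  have hS := norm_hermResolvent_apply_le (z := z) hv (zeroPair i j A)
  have hRS := norm_hermResolvent_sub_zeroPair_le (z := z) hv A hij
  have h1 := norm_pairTerm_sub_le (i := k) (j := l) hS hR hRS hRS c p q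
  have h2 := norm_conjDefect_sub_zeroPair_le (z := z) hρ hv a b A hij
  have h3 := norm_mul_sub_mul_le (norm_conjDefect_le hρ hv a b A)
    (norm_pairTerm_le (i := k) (j := l) hS hS c p q) h1 h2
  rw [norm_sub_rev]
  refine h3.trans ?_
  set L := ‖z‖ + v + 4
  set s := invSqrt n
  set r := pairSize A i j
  have hs0 : 0 ≤ s := invSqrt_nonneg n
  have hs3 : s ^ 3 ≤ s := by
    have := pow_le_pow_of_le_one hs0 (invSqrt_le_one n) (show 1 ≤ 3 by norm_num)
    rwa [pow_one] at this
  have hr : 0 ≤ r := pairSize_nonneg A i j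
  have hL : 0 ≤ L := by positivity
  calc _ = L * (8 * s * r) + L * (4 * (s ^ 3 * r)) := by ring
    _ ≤ L * (8 * s * r) + L * (4 * (s * r)) := by gcongr
    _ = 12 * L * s * r := by ring
    _ ≤ _ := by
        gcongr
        nlinarith [sq_nonneg (r ^ 2 - 1), sq_nonneg (r - 1), sq_nonneg (r ^ 2 - r)]

/-- The diagonal entries of `(H - i v) R = 1` in row block `a`, averaged over the index, rewrite the
linear part of the defect as entries times resolvent elements. -/
theorem dysonDefect_blockTrace (hn : n ≠ 0) (hv : v ≠ 0) (ρ : ℝ) (A : Matrix (Fin n) (Fin n) ℝ)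
    (a b : Bool) : dysonDefect ρ z v (blockTrace z v A) a b =
      (n : ℂ)⁻¹ * (invSqrt n * ∑ i, ∑ j, orient a A i j * hermResolvent z v A (!a, j) (b, i)) +
      blockTrace z v A (!a) (!a) * blockTrace z v A a b +
      ρ * (blockTrace z v A (!a) a * blockTrace z v A (!a) b) := by
  have h : ∀ i, (∑ j, (invSqrt n : ℂ) * (orient a A i j * hermResolvent z v A (!a, j) (b, i)))
      = (if a = b then 1 else 0) + orientShift a z * hermResolvent z v A (!a, i) (b, i)
        + Complex.I * v * hermResolvent z v A (a, i) (b, i) := by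
    intro i
    have h := congrFun (congrFun (sub_imag_mul_imagResolvent (isHermitian_shiftedHerm A z) hv)
      (a, i)) (b, i)
    change ((shiftedHerm A z - (Complex.I * v) • 1) * hermResolvent z v A) (a, i) (b, i) = _ at h
    rw [sub_mul, Matrix.sub_apply, smul_mul_assoc, one_mul, Matrix.smul_apply, Matrix.mul_apply,
      Fintype.sum_prod_type] at h
    have h1 : ∀ f : Bool → ℂ, ∑ c, f c = f a + f (!a) := by intro f; cases a <;> simp [add_comm]
    have h2 : (!a) ≠ a := by cases a <;> simp
    rw [h1] at h
    simp only [shiftedHerm_apply, if_true, if_neg h2, zero_mul, Finset.sum_const_zero, zero_add,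
      sub_mul, Finset.sum_sub_distrib, ite_mul, Finset.sum_ite_eq, Finset.mem_univ,
      Matrix.one_apply, Prod.mk.injEq, and_true, smul_eq_mul] at h
    simp only [← mul_assoc]
    linear_combination h
  unfold dysonDefect
  congr 2
  have hn' : (n : ℂ) ≠ 0 := Nat.cast_ne_zero.2 hn
  have h' : (invSqrt n : ℂ) * ∑ i, ∑ j, orient a A i j * hermResolvent z v A (!a, j) (b, i) =
      n * (if a = b then 1 else 0) + orientShift a z * ∑ i, hermResolvent z v A (!a, i) (b, i)
        + Complex.I * v * ∑ i, hermResolvent z v A (a, i) (b, i) := by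
    rw [Finset.mul_sum]
    simp_rw [Finset.mul_sum, h, Finset.sum_add_distrib]
    simp
  rw [h', blockTrace, blockTrace]
  field_simp

end Defect

/-! ### Measurability -/

instance Matrix.instMeasurableSpaceFin {n : ℕ} : MeasurableSpace (Matrix (Fin n) (Fin n) ℝ) :=
  MeasurableSpace.pi

theorem measurable_matrix_entry {n : ℕ} (i j : Fin n) :
    Measurable fun A : Matrix (Fin n) (Fin n) ℝ => A i j :=
  (measurable_pi_apply j).comp (measurable_pi_apply (X := fun _ : Fin n => Fin n → ℝ) i)

theorem measurable_matrix_of_entries {α : Type*} [MeasurableSpace α] {n : ℕ}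
    {f : α → Matrix (Fin n) (Fin n) ℝ} (hf : ∀ i j, Measurable fun x => f x i j) : Measurable f :=
  measurable_pi_lambda _ fun i => measurable_pi_lambda _ fun j => hf i j

section Measurability

variable {α ι : Type*} [MeasurableSpace α] [Fintype ι] [DecidableEq ι]

theorem measurable_det {M : α → Matrix ι ι ℂ} (hM : ∀ i j, Measurable fun x => M x i j) :
    Measurable fun x => (M x).det := by
  simp only [Matrix.det_apply]
  refine Finset.measurable_sum _ fun σ _ => Measurable.const_smul ?_ _
  exact Finset.measurable_prod _ fun i _ => hM _ _

theorem measurable_inv_apply {M : α → Matrix ι ι ℂ} (hM : ∀ i j, Measurable fun x => M x i j)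
    (i j : ι) : Measurable fun x => (M x)⁻¹ i j := by
  simp only [Matrix.inv_def, Matrix.smul_apply, smul_eq_mul, Ring.inverse_eq_inv',
    Matrix.adjugate_apply]
  refine (measurable_det hM).inv.mul (measurable_det fun k l => ?_)
  simp only [Matrix.updateRow_apply]
  split_ifs
  · exact measurable_const
  · exact hM k l

end Measurability

section MatrixMeasurability

variable {n : ℕ}

theorem measurable_hermResolvent (z : ℂ) (v : ℝ) (p q : Bool × Fin n) :
    Measurable fun A : Matrix (Fin n) (Fin n) ℝ => hermResolvent z v A p q := by
  refine measurable_inv_apply (fun i j => ?_) p q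
  simp only [Matrix.sub_apply, shiftedHerm_apply]
  refine Measurable.sub ?_ measurable_const
  split_ifs
  · exact measurable_const
  all_goals
    refine Measurable.sub (Measurable.const_mul (Complex.measurable_ofReal.comp ?_) _)
      measurable_const
    unfold orient
    split_ifs <;> exact measurable_matrix_entry _ _

theorem measurable_blockTrace (z : ℂ) (v : ℝ) (a b : Bool) :
    Measurable fun A : Matrix (Fin n) (Fin n) ℝ => blockTrace z v A a b :=
  (Finset.measurable_sum _ fun _ _ => measurable_hermResolvent z v _ _).const_mul _

theorem measurable_dysonDefect_blockTrace (ρ : ℝ) (z : ℂ) (v : ℝ) (a b : Bool) :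
    Measurable fun A : Matrix (Fin n) (Fin n) ℝ => dysonDefect ρ z v (blockTrace z v A) a b := by
  have h := fun a b => measurable_blockTrace (n := n) z v a b
  unfold dysonDefect
  exact (((measurable_const.add ((h _ _).const_mul _)).add ((h _ _).const_mul _)).add
    ((h _ _).mul (h _ _))).add (((h _ _).mul (h _ _)).const_mul _)

theorem measurable_conjDefect (ρ : ℝ) (z : ℂ) (v : ℝ) (a b : Bool) :
    Measurable fun A : Matrix (Fin n) (Fin n) ℝ => conjDefect ρ z v a b A :=
  Complex.continuous_conj.measurable.comp (measurable_dysonDefect_blockTrace ρ z v a b)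

theorem measurable_pairTerm (z : ℂ) (v : ℝ) (a : Bool) (i j : Fin n) (p q : Bool × Fin n) :
    Measurable fun A : Matrix (Fin n) (Fin n) ℝ =>
      pairTerm a i j (hermResolvent z v A) (hermResolvent z v A) p q := by
  have h := fun p q => measurable_hermResolvent (n := n) z v p q
  exact ((h _ _).mul (h _ _)).add ((h _ _).mul (h _ _))

theorem measurable_zeroPair (i j : Fin n) :
    Measurable (zeroPair i j : Matrix (Fin n) (Fin n) ℝ → _) := by
  refine measurable_matrix_of_entries fun k l => ?_
  unfold zeroPair
  split_ifs
  · exact measurable_const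
  · exact measurable_matrix_entry _ _

theorem zeroPair_comm (i j : Fin n) (A : Matrix (Fin n) (Fin n) ℝ) :
    zeroPair i j A = zeroPair j i A := by
  ext k l
  simp only [zeroPair, or_comm]

end MatrixMeasurability

/-! ### Independence and moments of a pair -/

/-- The joint law factors as `(U ⊗ V) ⊗ W`, and product measures are associative. It merges the two
independence assumptions, among pairs and between diagonal and off-diagonal part. -/
theorem IndepFun.prodMk_of_indepFun_prodMk {Ω α β γ : Type*} [MeasurableSpace Ω]
    [MeasurableSpace α] [MeasurableSpace β] [MeasurableSpace γ] {P : Measure Ω}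
    [IsProbabilityMeasure P] {U : Ω → α} {V : Ω → β} {W : Ω → γ} (hU : Measurable U)
    (hV : Measurable V) (hW : Measurable W) (hUV : IndepFun U V P)
    (hUVW : IndepFun (fun ω => (U ω, V ω)) W P) : IndepFun U (fun ω => (V ω, W ω)) P := by
  have : IsProbabilityMeasure (P.map U) := Measure.isProbabilityMeasure_map hU.aemeasurable
  have : IsProbabilityMeasure (P.map V) := Measure.isProbabilityMeasure_map hV.aemeasurable
  have : IsProbabilityMeasure (P.map W) := Measure.isProbabilityMeasure_map hW.aemeasurable
  have hVW : IndepFun V W P := hUVW.comp measurable_snd measurable_id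
  rw [indepFun_iff_map_prod_eq_prod_map_map hU.aemeasurable (hV.prodMk hW).aemeasurable,
    (indepFun_iff_map_prod_eq_prod_map_map hV.aemeasurable hW.aemeasurable).1 hVW,
    ← Measure.prodAssoc_prod,
    ← (indepFun_iff_map_prod_eq_prod_map_map hU.aemeasurable hV.aemeasurable).1 hUV,
    ← (indepFun_iff_map_prod_eq_prod_map_map (hU.prodMk hV).aemeasurable hW.aemeasurable).1 hUVW,
    Measure.map_map (MeasurableEquiv.measurable _) ((hU.prodMk hV).prodMk hW)]
  rfl

theorem one_add_pairSize_pow_le {n : ℕ} (A : Matrix (Fin n) (Fin n) ℝ) (i j : Fin n) :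
    1 + pairSize A i j ^ 4 ≤ 1 + 8 * (|A i j| ^ 4 + |A j i| ^ 4) := by
  have h := add_pow_le (abs_nonneg (A i j)) (abs_nonneg (A j i)) 4
  norm_num at h
  unfold pairSize
  linarith

section Model

variable {Ω : Type*} [MeasurableSpace Ω] {P : Measure Ω} {ρ M₄ : ℝ}
  {X : (n : ℕ) → Fin n → Fin n → Ω → ℝ}

/-- The random matrix with entries `X n i j`. -/
def sampleMatrix (X : (n : ℕ) → Fin n → Fin n → Ω → ℝ) (n : ℕ) (ω : Ω) :
    Matrix (Fin n) (Fin n) ℝ := Matrix.of fun i j => X n i j ω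

namespace ConditionC0

theorem measurable_sampleMatrix (hX : ConditionC0 P ρ M₄ X) (n : ℕ) :
    Measurable (sampleMatrix X n) :=
  measurable_matrix_of_entries fun i j => hX.measurable n i j

theorem integral_orient (hX : ConditionC0 P ρ M₄ X) {n : ℕ} {i j : Fin n} (hij : i ≠ j)
    (c : Bool) : ∫ ω, orient c (sampleMatrix X n ω) i j ∂P = 0 := by
  cases c
  · exact hX.mean_offDiag n i j hij
  · exact hX.mean_offDiag n j i hij.symm

theorem integral_orient_sq (hX : ConditionC0 P ρ M₄ X) {n : ℕ} {i j : Fin n} (hij : i ≠ j)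
    (c : Bool) : ∫ ω, orient c (sampleMatrix X n ω) i j ^ 2 ∂P = 1 := by
  cases c
  · exact hX.variance_offDiag n i j hij
  · exact hX.variance_offDiag n j i hij.symm

theorem integral_orient_mul (hX : ConditionC0 P ρ M₄ X) {n : ℕ} {i j : Fin n} (hij : i ≠ j)
    (c : Bool) :
    ∫ ω, orient c (sampleMatrix X n ω) i j * orient c (sampleMatrix X n ω) j i ∂P = ρ := by
  cases c
  · exact hX.correlation n i j hij
  · exact hX.correlation n j i hij.symm

theorem integrable_pow_four (hX : ConditionC0 P ρ M₄ X) {n : ℕ} {i j : Fin n} (hij : i ≠ j) :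
    Integrable (fun ω => |X n i j ω| ^ 4) P := by
  simpa using (hX.memLp_offDiag n i j hij).integrable_norm_pow (by norm_num)

variable [IsProbabilityMeasure P]

theorem indepFun_pair_zeroPair_of_lt (hX : ConditionC0 P ρ M₄ X) {n : ℕ} {i j : Fin n}
    (hij : i < j) : IndepFun (fun ω => (X n i j ω, X n j i ω))
      (fun ω => zeroPair i j (sampleMatrix X n ω)) P := by
  let p₀ : {p : Fin n × Fin n // p.1 < p.2} := ⟨(i, j), hij⟩
  let pair : {p : Fin n × Fin n // p.1 < p.2} → Ω → ℝ × ℝ :=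
    fun p ω => (X n p.1.1 p.1.2 ω, X n p.1.2 p.1.1 ω)
  have hpair : ∀ p, Measurable (pair p) :=
    fun p => (hX.measurable n _ _).prodMk (hX.measurable n _ _)
  let T : Finset {p : Fin n × Fin n // p.1 < p.2} := {p₀}ᶜ
  let V : Ω → (T → ℝ × ℝ) := fun ω p => pair p ω
  have hV : Measurable V := measurable_pi_lambda _ fun p => hpair p
  let W : Ω → (Fin n → ℝ) := fun ω k => X n k k ω
  have hW : Measurable W := measurable_pi_lambda _ fun k => hX.measurable n k k
  have hUV : IndepFun (pair p₀) V P := by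
    have h := (hX.indep_pairs n).indepFun_finset {p₀} T disjoint_compl_right hpair
    exact h.comp (φ := fun f : ({p₀} : Finset _) → ℝ × ℝ => f ⟨p₀, Finset.mem_singleton_self _⟩)
      (measurable_pi_apply _) measurable_id
  have hUVW : IndepFun (fun ω => (pair p₀ ω, V ω)) W P := by
    have h := (hX.indep_diag_offDiag n).symm
    refine h.comp (φ := fun f : {p : Fin n × Fin n // p.1 ≠ p.2} → ℝ =>
      (((f ⟨(i, j), hij.ne⟩, f ⟨(j, i), hij.ne'⟩) : ℝ × ℝ),
        fun p : T => (f ⟨(p.1.1.1, p.1.1.2), p.1.2.ne⟩, f ⟨(p.1.1.2, p.1.1.1), p.1.2.ne'⟩)))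
      ?_ measurable_id
    refine ((measurable_pi_apply _).prodMk (measurable_pi_apply _)).prodMk
      (measurable_pi_lambda _ fun p => (measurable_pi_apply _).prodMk (measurable_pi_apply _))
  have h := IndepFun.prodMk_of_indepFun_prodMk (hpair p₀) hV hW hUV hUVW
  have hT : ∀ {k l : Fin n} (hkl : k < l), ¬ (i = k ∧ j = l) →
      (⟨(k, l), hkl⟩ : {p : Fin n × Fin n // p.1 < p.2}) ∈ T := by
    intro k l hkl hne
    simp only [T, Finset.mem_compl, Finset.mem_singleton, p₀, Subtype.mk.injEq, Prod.mk.injEq]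
    tauto
  -- Rebuilds the deleted matrix from the other pairs and the diagonal; an entry below the diagonal
  -- is the second component of its pair.
  let ψ : (T → ℝ × ℝ) × (Fin n → ℝ) → Matrix (Fin n) (Fin n) ℝ := fun x k l =>
    if h : (i = k ∧ j = l) ∨ (j = k ∧ i = l) then 0 else
      if hkl : k < l then (x.1 ⟨⟨(k, l), hkl⟩, hT hkl fun h' => h (Or.inl h')⟩).1
      else if hlk : l < k then
        (x.1 ⟨⟨(l, k), hlk⟩, hT hlk fun h' => h (Or.inr ⟨h'.2, h'.1⟩)⟩).2
      else x.2 k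
  have hψ : Measurable ψ := by
    refine measurable_matrix_of_entries fun k l => ?_
    simp only [ψ]
    split_ifs
    · exact measurable_const
    · exact ((measurable_pi_apply _).comp measurable_fst).fst
    · exact ((measurable_pi_apply _).comp measurable_fst).snd
    · exact (measurable_pi_apply _).comp measurable_snd
  have hcomp := h.comp (φ := id) measurable_id hψ
  suffices e : (fun ω => zeroPair i j (sampleMatrix X n ω)) = ψ ∘ fun ω => (V ω, W ω) by
    rw [e]
    exact hcomp
  funext ω
  ext k l
  change zeroPair i j (sampleMatrix X n ω) k l = ψ (V ω, W ω) k l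
  simp only [zeroPair, sampleMatrix, ψ, V, W, pair, Matrix.of_apply]
  split_ifs with h1 h2 h3
  · rfl
  · rfl
  · rfl
  · have : k = l := le_antisymm (not_lt.1 h3) (not_lt.1 h2)
    rw [this]

theorem indepFun_pair_zeroPair (hX : ConditionC0 P ρ M₄ X) {n : ℕ} {i j : Fin n}
    (hij : i ≠ j) : IndepFun (fun ω => (X n i j ω, X n j i ω))
      (fun ω => zeroPair i j (sampleMatrix X n ω)) P := by
  rcases lt_or_gt_of_ne hij with h | h
  · exact hX.indepFun_pair_zeroPair_of_lt h
  · have := (hX.indepFun_pair_zeroPair_of_lt h).comp measurable_swap measurable_id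
    simpa only [Function.comp_def, zeroPair_comm j i, Prod.swap, id] using this

theorem integral_mul_zeroPair (hX : ConditionC0 P ρ M₄ X) {n : ℕ} {i j : Fin n} (hij : i ≠ j)
    (c : Bool) {φ : ℝ × ℝ → ℝ} (hφ : Measurable φ) {G : Matrix (Fin n) (Fin n) ℝ → ℂ}
    (hG : Measurable G) :
    ∫ ω, (φ (orient c (sampleMatrix X n ω) i j, orient c (sampleMatrix X n ω) j i) : ℂ) *
        G (zeroPair i j (sampleMatrix X n ω)) ∂P =
      ((∫ ω, φ (orient c (sampleMatrix X n ω) i j, orient c (sampleMatrix X n ω) j i) ∂P : ℝ) : ℂ)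
        * ∫ ω, G (zeroPair i j (sampleMatrix X n ω)) ∂P := by
  have h : IndepFun
      (fun ω => (orient c (sampleMatrix X n ω) i j, orient c (sampleMatrix X n ω) j i))
      (fun ω => zeroPair i j (sampleMatrix X n ω)) P := by
    cases c
    · exact hX.indepFun_pair_zeroPair hij
    · exact (hX.indepFun_pair_zeroPair hij).comp measurable_swap measurable_id
  have h2 := h.comp (Complex.measurable_ofReal.comp hφ) hG
  rw [← integral_complex_ofReal]
  refine h2.integral_fun_mul_eq_mul_integral ?_ ?_
  · refine ((Complex.measurable_ofReal.comp hφ).comp (Measurable.prodMk ?_ ?_)).aestronglyMeasurable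
    all_goals
      cases c
      · exact hX.measurable n _ _
      · exact hX.measurable n _ _
  · exact (hG.comp ((measurable_zeroPair i j).comp
      (hX.measurable_sampleMatrix n))).aestronglyMeasurable

theorem integrable_pairSize_pow (hX : ConditionC0 P ρ M₄ X) {n : ℕ} {i j : Fin n} (hij : i ≠ j) :
    Integrable (fun ω => 1 + pairSize (sampleMatrix X n ω) i j ^ 4) P := by
  refine Integrable.mono' (g := fun ω => 1 + 8 * (|X n i j ω| ^ 4 + |X n j i ω| ^ 4))
    ((integrable_const 1).add (((hX.integrable_pow_four hij).add
      (hX.integrable_pow_four hij.symm)).const_mul 8)) ?_ ?_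
  · unfold pairSize
    have h1 : Measurable fun ω => sampleMatrix X n ω i j := hX.measurable n i j
    have h2 : Measurable fun ω => sampleMatrix X n ω j i := hX.measurable n j i
    exact Measurable.aestronglyMeasurable (by fun_prop)
  · refine Eventually.of_forall fun ω => ?_
    rw [Real.norm_of_nonneg (by have := pairSize_nonneg (sampleMatrix X n ω) i j; positivity)]
    exact one_add_pairSize_pow_le (sampleMatrix X n ω) i j

theorem integral_pairSize_pow_le (hX : ConditionC0 P ρ M₄ X) {n : ℕ} {i j : Fin n} (hij : i ≠ j) :
    ∫ ω, 1 + pairSize (sampleMatrix X n ω) i j ^ 4 ∂P ≤ 1 + 16 * M₄ := by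
  have h1 := hX.integrable_pow_four hij
  have h2 := hX.integrable_pow_four hij.symm
  calc _ ≤ ∫ ω, 1 + 8 * (|X n i j ω| ^ 4 + |X n j i ω| ^ 4) ∂P :=
        integral_mono (hX.integrable_pairSize_pow hij)
          ((integrable_const 1).add ((h1.add h2).const_mul 8))
          fun ω => one_add_pairSize_pow_le (sampleMatrix X n ω) i j
    _ = 1 + 8 * (∫ ω, |X n i j ω| ^ 4 ∂P + ∫ ω, |X n j i ω| ^ 4 ∂P) := by
        have h3 : Integrable (fun ω => 8 * (|X n i j ω| ^ 4 + |X n j i ω| ^ 4)) P :=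
          (h1.add h2).const_mul 8
        rw [integral_add (integrable_const 1) h3, integral_const_mul, integral_add h1 h2]
        simp
    _ ≤ _ := by
        linarith [hX.fourth_moment_offDiag n i j hij, hX.fourth_moment_offDiag n j i hij.symm]

end ConditionC0

end Model

theorem MeasureTheory.Integrable.ofReal_mul_of_norm_le {Ω : Type*} [MeasurableSpace Ω]
    {P : Measure Ω} {w : Ω → ℝ} (hw : Integrable w P) {G : Ω → ℂ} (hG : Measurable G) {C : ℝ}
    (hC : ∀ ω, ‖G ω‖ ≤ C) : Integrable (fun ω => (w ω : ℂ) * G ω) P := by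
  refine (hw.norm.mul_const C).mono' (hw.ofReal.1.mul hG.aestronglyMeasurable)
    (Eventually.of_forall fun ω => ?_)
  rw [norm_mul, Complex.norm_real]
  exact mul_le_mul_of_nonneg_left (hC ω) (norm_nonneg _)

theorem MeasureTheory.integral_add_mul_add {Ω : Type*} [MeasurableSpace Ω] {P : Measure Ω}
    {f g h : Ω → ℂ} (hf : Integrable f P) (hg : Integrable g P) (hh : Integrable h P) (c d : ℂ) :
    ∫ ω, (f ω + c * (g ω + d * h ω)) ∂P =
      ∫ ω, f ω ∂P + c * (∫ ω, g ω ∂P + d * ∫ ω, h ω ∂P) := by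
  have h1 : Integrable (fun ω => d * h ω) P := hh.const_mul d
  have h2 : Integrable (fun ω => c * (g ω + d * h ω)) P := (hg.add h1).const_mul c
  rw [integral_add hf h2, integral_const_mul, integral_add hg h1, integral_const_mul]

/-! ### Algebraic form of the defect times a test factor -/

section Deterministic

variable {n : ℕ} {z : ℂ} {v : ℝ}

/-- The part of the double sum of pair terms that does not factor into block traces. -/
noncomputable def pairRemainder (ρ : ℝ) (a b : Bool)
    (R : Matrix (Bool × Fin n) (Bool × Fin n) ℂ) : ℂ :=
  ∑ i, ∑ j, R (!a, j) (a, i) * R (!a, j) (b, i) +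
    ρ * ∑ i, ∑ j, R (!a, j) (!a, i) * R (a, j) (b, i)

/-- For fixed `i` the sum over `j` is a product of two columns, at most one by Cauchy-Schwarz. The
double sum is thus of order `n` instead of `n²`. -/
theorem norm_pairRemainder_le {ρ : ℝ} (hρ : |ρ| ≤ 1) (hv : 1 ≤ v) (a b : Bool)
    (A : Matrix (Fin n) (Fin n) ℝ) : ‖pairRemainder ρ a b (hermResolvent z v A)‖ ≤ 2 * n := by
  have h : ∀ a b c d : Bool, ‖∑ i, ∑ j, hermResolvent z v A (a, j) (b, i) *
      hermResolvent z v A (c, j) (d, i)‖ ≤ n := by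
    intro a b c d
    calc _ ≤ ∑ i : Fin n, (1 : ℝ) := by
          refine norm_sum_le_of_le _ fun i _ => (norm_sum_le _ _).trans ?_
          simp only [norm_mul]
          exact sum_mul_le_one_of_sum_sq_le_one _ _ _ (sum_norm_sq_col_le hv A (b, i) a)
            (sum_norm_sq_col_le hv A (d, i) c)
      _ = n := by simp
  refine (norm_add_le _ _).trans ?_
  rw [norm_mul, Complex.norm_real, Real.norm_eq_abs]
  have h1 := h (!a) a (!a) b
  have h2 := h (!a) (!a) a b
  have h3 := mul_le_of_le_one_left (norm_nonneg (∑ i, ∑ j, hermResolvent z v A (!a, j) (!a, i) *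
      hermResolvent z v A (a, j) (b, i))) hρ
  linarith

theorem sum_pairTerm_eq (ρ : ℝ) (a b : Bool) (R : Matrix (Bool × Fin n) (Bool × Fin n) ℂ) :
    ∑ i, ∑ j, (pairTerm a i j R R (!a, j) (b, i) + ρ * pairTerm a j i R R (!a, j) (b, i)) =
      (∑ k, R (!a, k) (!a, k)) * (∑ k, R (a, k) (b, k)) +
      ρ * ((∑ k, R (!a, k) (a, k)) * (∑ k, R (!a, k) (b, k))) + pairRemainder ρ a b R := by
  have h1 : (∑ k, R (!a, k) (!a, k)) * (∑ k, R (a, k) (b, k)) =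
      ∑ i, ∑ j, R (!a, j) (!a, j) * R (a, i) (b, i) := by
    rw [Finset.sum_mul_sum, Finset.sum_comm]
  have h2 : (∑ k, R (!a, k) (a, k)) * (∑ k, R (!a, k) (b, k)) =
      ∑ i, ∑ j, R (!a, j) (a, j) * R (!a, i) (b, i) := by
    rw [Finset.sum_mul_sum, Finset.sum_comm]
  rw [h1, h2, pairRemainder]
  simp only [pairTerm, Finset.sum_add_distrib, mul_add, Finset.mul_sum]
  ring

/-- The quadratic part is distributed over the positions `(i, j)`, so that each summand pairs an
entry term with the compensator that cancels its expectation to leading order. -/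
theorem dysonDefect_blockTrace_mul (hn : n ≠ 0) (hv : v ≠ 0) (ρ : ℝ)
    (A : Matrix (Fin n) (Fin n) ℝ) (a b : Bool) (d : ℂ) :
    dysonDefect ρ z v (blockTrace z v A) a b * d =
      (invSqrt n : ℂ) ^ 3 * ∑ i, ∑ j, (orient a A i j * (hermResolvent z v A (!a, j) (b, i) * d) +
        invSqrt n * ((pairTerm a i j (hermResolvent z v A) (hermResolvent z v A) (!a, j) (b, i) +
          ρ * pairTerm a j i (hermResolvent z v A) (hermResolvent z v A) (!a, j) (b, i)) * d)) -
      (invSqrt n : ℂ) ^ 4 * (pairRemainder ρ a b (hermResolvent z v A) * d) := by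
  have hs : (n : ℂ)⁻¹ = (invSqrt n : ℂ) ^ 2 := by
    rw [← Complex.ofReal_pow, invSqrt_sq]
    push_cast
    rfl
  have h := sum_pairTerm_eq ρ a b (hermResolvent z v A)
  rw [dysonDefect_blockTrace hn hv]
  simp only [Finset.sum_add_distrib, ← Finset.mul_sum, ← Finset.sum_mul, ← mul_assoc] at h ⊢
  simp only [blockTrace, hs]
  linear_combination (-(invSqrt n : ℂ) ^ 4 * d) * h

end Deterministic

/-! ### Mean-square bound for the defect -/

namespace ConditionC0

variable {Ω : Type*} [MeasurableSpace Ω] {P : Measure Ω} [IsProbabilityMeasure P] {ρ M₄ : ℝ}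
  {X : (n : ℕ) → Fin n → Fin n → Ω → ℝ}

theorem memLp_two (hX : ConditionC0 P ρ M₄ X) (n : ℕ) (i j : Fin n) : MemLp (X n i j) 2 P := by
  by_cases hij : i = j
  · subst hij
    exact hX.memLp_diag n i
  · exact (hX.memLp_offDiag n i j hij).mono_exponent (by norm_num)

theorem memLp_two_orient (hX : ConditionC0 P ρ M₄ X) (n : ℕ) (c : Bool) (i j : Fin n) :
    MemLp (fun ω => orient c (sampleMatrix X n ω) i j) 2 P := by
  cases c
  · exact hX.memLp_two n i j
  · exact hX.memLp_two n j i

theorem integral_sub_le_of_norm_sub_le (hX : ConditionC0 P ρ M₄ X) {n : ℕ} {i j : Fin n}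
    (hij : i ≠ j) {F G : Ω → ℂ} (hF : Integrable F P) (hG : Integrable G P) {C : ℝ} (hC : 0 ≤ C)
    (h : ∀ ω, ‖F ω - G ω‖ ≤ C * (1 + pairSize (sampleMatrix X n ω) i j ^ 4)) :
    ‖∫ ω, F ω ∂P - ∫ ω, G ω ∂P‖ ≤ C * (1 + 16 * M₄) := by
  rw [← integral_sub hF hG]
  refine (norm_integral_le_of_norm_le ((hX.integrable_pairSize_pow hij).const_mul C)
    (Eventually.of_forall h)).trans ?_
  rw [integral_const_mul]
  exact mul_le_mul_of_nonneg_left (hX.integral_pairSize_pow_le hij) hC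

/-- An approximate integration by parts: `E[x R d] ≈ -n^{-1/2} E[(T_ij + ρ T_ji) d]`, with `d` the
conjugate defect and `T` the pair terms. The constant `30` is `6` for the expansion plus `2 · 12`
for undoing the deletion in the two pair terms. -/
theorem norm_integral_entry_add_le (hX : ConditionC0 P ρ M₄ X) (hρ : |ρ| ≤ 1) {z : ℂ} {v : ℝ}
    (hv : 1 ≤ v) (c a b : Bool) {n : ℕ} {i j : Fin n} (hij : i ≠ j) (p q : Bool × Fin n) :
    ‖∫ ω, (orient c (sampleMatrix X n ω) i j * (hermResolvent z v (sampleMatrix X n ω) p q *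
          conjDefect ρ z v a b (sampleMatrix X n ω)) +
        invSqrt n * ((pairTerm c i j (hermResolvent z v (sampleMatrix X n ω))
            (hermResolvent z v (sampleMatrix X n ω)) p q +
          ρ * pairTerm c j i (hermResolvent z v (sampleMatrix X n ω))
            (hermResolvent z v (sampleMatrix X n ω)) p q) *
          conjDefect ρ z v a b (sampleMatrix X n ω))) ∂P‖ ≤
      30 * (‖z‖ + v + 4) * invSqrt n ^ 2 * (1 + 16 * M₄) := by
  set A := sampleMatrix X n with hA
  have hAm : Measurable A := hX.measurable_sampleMatrix n
  have hZm : Measurable fun ω => zeroPair i j (A ω) := (measurable_zeroPair i j).comp hAm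
  set L := ‖z‖ + v + 4 with hL
  have hL0 : 0 ≤ L := by positivity
  set s := invSqrt n with hs
  have hs0 : 0 ≤ s := invSqrt_nonneg n
  let G₀ : Matrix (Fin n) (Fin n) ℝ → ℂ := fun B => hermResolvent z v B p q * conjDefect ρ z v a b B
  let G : Fin n → Fin n → Matrix (Fin n) (Fin n) ℝ → ℂ := fun k l B =>
    pairTerm c k l (hermResolvent z v B) (hermResolvent z v B) p q * conjDefect ρ z v a b B
  have hG₀m : Measurable G₀ :=
    (measurable_hermResolvent z v p q).mul (measurable_conjDefect ρ z v a b)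
  have hGm : ∀ k l, Measurable (G k l) :=
    fun k l => (measurable_pairTerm z v c k l p q).mul (measurable_conjDefect ρ z v a b)
  have hG₀b : ∀ B, ‖G₀ B‖ ≤ 1 * L := fun B => by
    rw [norm_mul]
    exact mul_le_mul (norm_hermResolvent_apply_le hv B p q) (norm_conjDefect_le hρ hv a b B)
      (norm_nonneg _) zero_le_one
  have hGb : ∀ k l B, ‖G k l B‖ ≤ 2 * L := fun k l B => by
    rw [norm_mul]
    exact mul_le_mul (norm_pairTerm_le (norm_hermResolvent_apply_le hv B)
      (norm_hermResolvent_apply_le hv B) c p q) (norm_conjDefect_le hρ hv a b B)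
      (norm_nonneg _) zero_le_two
  have hx2 := hX.memLp_two_orient n c i j
  have hy2 := hX.memLp_two_orient n c j i
  have hx : Integrable (fun ω => orient c (A ω) i j) P := hx2.integrable (by norm_num)
  have hxx : Integrable (fun ω => orient c (A ω) i j ^ 2) P := hx2.integrable_sq
  have hxy : Integrable (fun ω => orient c (A ω) i j * orient c (A ω) j i) P :=
    hx2.integrable_mul hy2
  have hGi : ∀ k l, Integrable (fun ω => G k l (A ω)) P := fun k l =>
    Integrable.of_bound ((hGm k l).comp hAm).aestronglyMeasurable (2 * L)
      (Eventually.of_forall fun ω => hGb k l _)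
  have hGzi : ∀ k l, Integrable (fun ω => G k l (zeroPair i j (A ω))) P := fun k l =>
    Integrable.of_bound ((hGm k l).comp hZm).aestronglyMeasurable (2 * L)
      (Eventually.of_forall fun ω => hGb k l _)
  have hFi : Integrable (fun ω => (orient c (A ω) i j : ℂ) * G₀ (A ω)) P :=
    hx.ofReal_mul_of_norm_le (hG₀m.comp hAm) fun ω => hG₀b _
  have hF1 : Integrable (fun ω => (orient c (A ω) i j : ℂ) * G₀ (zeroPair i j (A ω))) P :=
    hx.ofReal_mul_of_norm_le (hG₀m.comp hZm) fun ω => hG₀b _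
  have hF2 : Integrable (fun ω => ((orient c (A ω) i j ^ 2 : ℝ) : ℂ) *
      G i j (zeroPair i j (A ω))) P :=
    hxx.ofReal_mul_of_norm_le ((hGm i j).comp hZm) fun ω => hGb i j _
  have hF3 : Integrable (fun ω => ((orient c (A ω) i j * orient c (A ω) j i : ℝ) : ℂ) *
      G j i (zeroPair i j (A ω))) P :=
    hxy.ofReal_mul_of_norm_le ((hGm j i).comp hZm) fun ω => hGb j i _
  -- By independence the order-zero term vanishes with the mean of the entry; the first-order terms
  -- keep its variance `1` and the correlation `ρ`.
  have e1 : ∫ ω, (orient c (A ω) i j : ℂ) * G₀ (zeroPair i j (A ω)) ∂P = 0 := by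
    have h := hX.integral_mul_zeroPair hij c (φ := fun x => x.1) measurable_fst hG₀m
    rw [hX.integral_orient hij c] at h
    simpa using h
  have e2 : ∫ ω, ((orient c (A ω) i j ^ 2 : ℝ) : ℂ) * G i j (zeroPair i j (A ω)) ∂P =
      ∫ ω, G i j (zeroPair i j (A ω)) ∂P := by
    have h := hX.integral_mul_zeroPair hij c (φ := fun x => x.1 ^ 2) (by fun_prop) (hGm i j)
    rw [hX.integral_orient_sq hij c, Complex.ofReal_one, one_mul] at h
    exact h
  have e3 : ∫ ω, ((orient c (A ω) i j * orient c (A ω) j i : ℝ) : ℂ) *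
      G j i (zeroPair i j (A ω)) ∂P = ρ * ∫ ω, G j i (zeroPair i j (A ω)) ∂P := by
    have h := hX.integral_mul_zeroPair hij c (φ := fun x => x.1 * x.2) (by fun_prop) (hGm j i)
    rw [hX.integral_orient_mul hij c] at h
    exact h
  have hFh : Integrable (fun ω => (orient c (A ω) i j : ℂ) * G₀ (zeroPair i j (A ω)) -
      s * (((orient c (A ω) i j ^ 2 : ℝ) : ℂ) * G i j (zeroPair i j (A ω)) +
        ((orient c (A ω) i j * orient c (A ω) j i : ℝ) : ℂ) * G j i (zeroPair i j (A ω)))) P :=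
    hF1.sub ((hF2.add hF3).const_mul _)
  have e4 : ∫ ω, ((orient c (A ω) i j : ℂ) * G₀ (zeroPair i j (A ω)) -
      s * (((orient c (A ω) i j ^ 2 : ℝ) : ℂ) * G i j (zeroPair i j (A ω)) +
        ((orient c (A ω) i j * orient c (A ω) j i : ℝ) : ℂ) * G j i (zeroPair i j (A ω)))) ∂P =
      -(s * (∫ ω, G i j (zeroPair i j (A ω)) ∂P + ρ * ∫ ω, G j i (zeroPair i j (A ω)) ∂P)) := by
    have h := integral_add_mul_add hF1 hF2 hF3 (-s) 1
    rw [e1, e2, e3] at h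
    simpa only [neg_mul, one_mul, ← sub_eq_add_neg, zero_sub] using h
  have b1 := hX.integral_sub_le_of_norm_sub_le hij hFi hFh (C := 6 * L * s ^ 2) (by positivity)
    fun ω => by
      have h := norm_entry_mul_conjDefect_sub_le (z := z) hρ hv c a b (A ω) hij p q
      refine le_trans (le_of_eq (congrArg _ ?_)) h
      simp only [G₀, G]
      push_cast
      ring
  have b2 : ∀ k l, ‖∫ ω, G k l (zeroPair i j (A ω)) ∂P - ∫ ω, G k l (A ω) ∂P‖ ≤
      12 * L * s * (1 + 16 * M₄) := fun k l =>
    hX.integral_sub_le_of_norm_sub_le hij (hGzi k l) (hGi k l) (by positivity) fun ω =>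
      norm_pairTerm_mul_conjDefect_sub_le hρ hv c a b (A ω) hij k l p q
  have e5 : ∫ ω, ((orient c (A ω) i j : ℂ) * G₀ (A ω) +
      s * (G i j (A ω) + ρ * G j i (A ω))) ∂P = ∫ ω, (orient c (A ω) i j : ℂ) * G₀ (A ω) ∂P +
      s * (∫ ω, G i j (A ω) ∂P + ρ * ∫ ω, G j i (A ω) ∂P) :=
    integral_add_mul_add hFi (hGi i j) (hGi j i) s ρ
  have e6 : ∫ ω, (orient c (A ω) i j * (hermResolvent z v (A ω) p q * conjDefect ρ z v a b (A ω)) +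
        s * ((pairTerm c i j (hermResolvent z v (A ω)) (hermResolvent z v (A ω)) p q +
          ρ * pairTerm c j i (hermResolvent z v (A ω)) (hermResolvent z v (A ω)) p q) *
          conjDefect ρ z v a b (A ω))) ∂P =
      ∫ ω, ((orient c (A ω) i j : ℂ) * G₀ (A ω) + s * (G i j (A ω) + ρ * G j i (A ω))) ∂P := by
    congr 1 with ω
    simp only [G₀, G]
    ring
  rw [e6, e5]
  rw [e4, sub_neg_eq_add] at b1
  have key : ∀ F T1 T2 T1' T2' : ℂ, F + s * (T1 + ρ * T2) =
      (F + s * (T1' + ρ * T2')) - s * ((T1' - T1) + ρ * (T2' - T2)) := by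
    intros; ring
  rw [key _ _ _ (∫ ω, G i j (zeroPair i j (A ω)) ∂P) (∫ ω, G j i (zeroPair i j (A ω)) ∂P)]
  refine (norm_sub_le _ _).trans ?_
  have b3 : ‖(s : ℂ) * ((∫ ω, G i j (zeroPair i j (A ω)) ∂P - ∫ ω, G i j (A ω) ∂P) +
      ρ * (∫ ω, G j i (zeroPair i j (A ω)) ∂P - ∫ ω, G j i (A ω) ∂P))‖ ≤
      s * (24 * L * s * (1 + 16 * M₄)) := by
    rw [norm_mul, Complex.norm_real, Real.norm_of_nonneg hs0]
    refine mul_le_mul_of_nonneg_left ((norm_add_le _ _).trans ?_) hs0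
    rw [norm_mul, Complex.norm_real, Real.norm_eq_abs]
    linarith [b2 i j, (mul_le_of_le_one_left (norm_nonneg _) hρ).trans (b2 j i)]
  linarith

/-- No cancellation is needed here: the `n` diagonal positions, weighted by `n^{-3/2}`, contribute
`O(n^{-1/2})` in total. -/
theorem norm_integral_diag_le (hX : ConditionC0 P ρ M₄ X) (hρ : |ρ| ≤ 1) {z : ℂ} {v : ℝ}
    (hv : 1 ≤ v) (c a b : Bool) {n : ℕ} (i : Fin n) (p q : Bool × Fin n) :
    ‖∫ ω, (orient c (sampleMatrix X n ω) i i * (hermResolvent z v (sampleMatrix X n ω) p q *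
          conjDefect ρ z v a b (sampleMatrix X n ω)) +
        invSqrt n * ((pairTerm c i i (hermResolvent z v (sampleMatrix X n ω))
            (hermResolvent z v (sampleMatrix X n ω)) p q +
          ρ * pairTerm c i i (hermResolvent z v (sampleMatrix X n ω))
            (hermResolvent z v (sampleMatrix X n ω)) p q) *
          conjDefect ρ z v a b (sampleMatrix X n ω))) ∂P‖ ≤
      (‖z‖ + v + 4) * (∫ ω, X n i i ω ^ 2 ∂P + 5) := by
  have hi : Integrable (fun ω => (‖z‖ + v + 4) * (X n i i ω ^ 2 + 5)) P :=
    ((hX.memLp_two n i i).integrable_sq.add (integrable_const 5)).const_mul _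
  refine (norm_integral_le_of_norm_le hi (Eventually.of_forall fun ω => ?_)).trans (le_of_eq ?_)
  swap
  · rw [integral_const_mul, integral_add (hX.memLp_two n i i).integrable_sq (integrable_const 5)]
    simp
  set A := sampleMatrix X n ω
  set R := hermResolvent z v A
  set L := ‖z‖ + v + 4
  have hL0 : 0 ≤ L := by positivity
  have hR : ∀ p q, ‖R p q‖ ≤ 1 := norm_hermResolvent_apply_le hv A
  have hd : ‖conjDefect ρ z v a b A‖ ≤ L := norm_conjDefect_le hρ hv a b A
  have ho : orient c A i i = X n i i ω := by cases c <;> rfl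
  have hx : |X n i i ω| ≤ X n i i ω ^ 2 + 1 := by
    rw [← sq_abs]
    nlinarith [sq_nonneg (|X n i i ω| - 1), abs_nonneg (X n i i ω)]
  have hp := norm_pairTerm_le (i := i) (j := i) hR hR c p q
  refine (norm_add_le _ _).trans ?_
  have h1 : ‖(orient c A i i : ℂ) * (R p q * conjDefect ρ z v a b A)‖ ≤
      (X n i i ω ^ 2 + 1) * (1 * L) := by
    rw [ho, norm_mul, norm_mul, Complex.norm_real]
    exact mul_le_mul hx (mul_le_mul (hR p q) hd (norm_nonneg _) zero_le_one) (by positivity)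
      (by positivity)
  have h2 : ‖(invSqrt n : ℂ) * ((pairTerm c i i R R p q + ρ * pairTerm c i i R R p q) *
      conjDefect ρ z v a b A)‖ ≤ 1 * (4 * L) := by
    rw [norm_mul, norm_mul, Complex.norm_real, Real.norm_of_nonneg (invSqrt_nonneg n)]
    refine mul_le_mul (invSqrt_le_one n) (mul_le_mul ((norm_add_le _ _).trans ?_) hd (norm_nonneg _)
      (by norm_num)) (by positivity) zero_le_one
    rw [norm_mul, Complex.norm_real, Real.norm_eq_abs]
    linarith [(mul_le_of_le_one_left (norm_nonneg (pairTerm c i i R R p q)) hρ)]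
  linarith

theorem integral_norm_sq_dysonDefect_le (hX : ConditionC0 P ρ M₄ X) (hρ : |ρ| ≤ 1) {z : ℂ} {v : ℝ}
    (hv : 1 ≤ v) (a b : Bool) {n : ℕ} (hn : n ≠ 0) {σ : ℝ}
    (hσ : ∀ i, ∫ ω, X n i i ω ^ 2 ∂P ≤ σ) :
    ∫ ω, ‖dysonDefect ρ z v (blockTrace z v (sampleMatrix X n ω)) a b‖ ^ 2 ∂P ≤
      (‖z‖ + v + 4) * (σ + 7 + 30 * (1 + 16 * |M₄|)) * invSqrt n := by
  have hA : Measurable (sampleMatrix X n) := hX.measurable_sampleMatrix n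
  set A := sampleMatrix X n
  set L := ‖z‖ + v + 4
  have hL0 : 0 ≤ L := by positivity
  set s := invSqrt n
  have hs0 : 0 ≤ s := invSqrt_nonneg n
  have hs1 : s ≤ 1 := invSqrt_le_one n
  have hsn : s ^ 2 * n = 1 := by
    rw [invSqrt_sq]
    exact inv_mul_cancel₀ (Nat.cast_ne_zero.2 hn)
  let d : Ω → ℂ := fun ω => conjDefect ρ z v a b (A ω)
  let R : Ω → Matrix (Bool × Fin n) (Bool × Fin n) ℂ := fun ω => hermResolvent z v (A ω)
  have hdm : Measurable d := (measurable_conjDefect ρ z v a b).comp hA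
  have hdb : ∀ ω, ‖d ω‖ ≤ L := fun ω => norm_conjDefect_le hρ hv a b _
  have hRm : ∀ p q, Measurable fun ω => R ω p q := fun p q =>
    (measurable_hermResolvent z v p q).comp hA
  have hRb : ∀ ω p q, ‖R ω p q‖ ≤ 1 := fun ω p q => norm_hermResolvent_apply_le hv _ p q
  let F : Fin n → Fin n → Ω → ℂ := fun i j ω =>
    orient a (A ω) i j * (R ω (!a, j) (b, i) * d ω) +
      s * ((pairTerm a i j (R ω) (R ω) (!a, j) (b, i) +
        ρ * pairTerm a j i (R ω) (R ω) (!a, j) (b, i)) * d ω)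
  have hFi : ∀ i j, Integrable (F i j) P := by
    intro i j
    refine Integrable.add ?_ (Integrable.const_mul ?_ _)
    · refine ((hX.memLp_two_orient n a i j).integrable (by norm_num)).ofReal_mul_of_norm_le
        (C := 1 * L) ((hRm _ _).mul hdm) fun ω => ?_
      rw [norm_mul]
      exact mul_le_mul (hRb ω _ _) (hdb ω) (norm_nonneg _) zero_le_one
    · have hpm : ∀ k l, Measurable fun ω => pairTerm a k l (R ω) (R ω) (!a, j) (b, i) :=
        fun k l => (measurable_pairTerm z v a k l _ _).comp hA
      refine Integrable.of_bound
        (((hpm i j).add ((hpm j i).const_mul _)).mul hdm).aestronglyMeasurable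
        ((2 + 2) * L) (Eventually.of_forall fun ω => ?_)
      have hp : ∀ k l, ‖pairTerm a k l (R ω) (R ω) (!a, j) (b, i)‖ ≤ 2 :=
        fun k l => norm_pairTerm_le (hRb ω) (hRb ω) a _ _
      rw [norm_mul]
      refine mul_le_mul ((norm_add_le _ _).trans (add_le_add (hp i j) ?_)) (hdb ω) (norm_nonneg _)
        (by norm_num)
      rw [norm_mul, Complex.norm_real]
      exact (mul_le_of_le_one_left (norm_nonneg _) hρ).trans (hp j i)
  have hrem : Integrable (fun ω => pairRemainder ρ a b (R ω) * d ω) P := by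
    refine Integrable.of_bound (Measurable.mul ?_ hdm).aestronglyMeasurable (2 * n * L)
      (Eventually.of_forall fun ω => ?_)
    · refine Measurable.add ?_ (Measurable.const_mul ?_ _)
      all_goals exact Finset.measurable_sum _ fun i _ => Finset.measurable_sum _ fun j _ =>
        (hRm _ _).mul (hRm _ _)
    · rw [norm_mul]
      exact mul_le_mul (norm_pairRemainder_le hρ hv a b _) (hdb ω) (norm_nonneg _) (by positivity)
  have e1 : ((∫ ω, ‖dysonDefect ρ z v (blockTrace z v (A ω)) a b‖ ^ 2 ∂P : ℝ) : ℂ) =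
      (s : ℂ) ^ 3 * ∑ i, ∑ j, ∫ ω, F i j ω ∂P -
        (s : ℂ) ^ 4 * ∫ ω, pairRemainder ρ a b (R ω) * d ω ∂P := by
    rw [← integral_complex_ofReal]
    have : ∀ ω, ((‖dysonDefect ρ z v (blockTrace z v (A ω)) a b‖ ^ 2 : ℝ) : ℂ) =
        (s : ℂ) ^ 3 * ∑ i, ∑ j, F i j ω - (s : ℂ) ^ 4 * (pairRemainder ρ a b (R ω) * d ω) := by
      intro ω
      -- One factor of `D · conj D` is expanded; the other is the test factor `d`.
      rw [Complex.ofReal_pow, ← Complex.mul_conj']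
      exact dysonDefect_blockTrace_mul hn (by linarith) ρ (A ω) a b (d ω)
    simp_rw [this]
    rw [integral_sub ((integrable_finsetSum _ fun i _ => integrable_finsetSum _ fun j _ =>
        hFi i j).const_mul _) (hrem.const_mul _), integral_const_mul, integral_const_mul,
      integral_finsetSum _ fun i _ => integrable_finsetSum _ fun j _ => hFi i j]
    congr 3 with i
    rw [integral_finsetSum _ fun j _ => hFi i j]
  set K := 1 + 16 * |M₄|
  have hK0 : 0 ≤ K := by positivity
  have hbound : ∀ i j, ‖∫ ω, F i j ω ∂P‖ ≤
      (if i = j then L * (σ + 5) else 0) + 30 * L * s ^ 2 * K := by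
    intro i j
    have hnn : 0 ≤ 30 * L * s ^ 2 * K := by positivity
    split_ifs with hij
    · subst hij
      have := hX.norm_integral_diag_le hρ (z := z) hv a a b i (!a, i) (b, i)
      refine this.trans ?_
      have := mul_le_mul_of_nonneg_left (add_le_add_left (hσ i) 5) hL0
      linarith
    · refine (hX.norm_integral_entry_add_le hρ (z := z) hv a a b hij (!a, j) (b, i)).trans ?_
      rw [zero_add]
      refine mul_le_mul_of_nonneg_left ?_ (by positivity)
      linarith [le_abs_self M₄]
  have hsum : ‖∑ i, ∑ j, ∫ ω, F i j ω ∂P‖ ≤ n * (L * (σ + 5)) + n * (n * (30 * L * s ^ 2 * K)) := by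
    refine (norm_sum_le_of_le _ fun i _ => norm_sum_le_of_le _ fun j _ => hbound i j).trans ?_
    simp [Finset.sum_add_distrib]
  have hrem' : ‖∫ ω, pairRemainder ρ a b (R ω) * d ω ∂P‖ ≤ 2 * n * L := by
    refine (norm_integral_le_of_norm_le_const (C := 2 * n * L)
      (Eventually.of_forall fun ω => ?_)).trans ?_
    · rw [norm_mul]
      exact mul_le_mul (norm_pairRemainder_le hρ hv a b _) (hdb ω) (norm_nonneg _) (by positivity)
    · simp
  have hnn : 0 ≤ ∫ ω, ‖dysonDefect ρ z v (blockTrace z v (A ω)) a b‖ ^ 2 ∂P :=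
    integral_nonneg fun ω => by positivity
  calc _ = ‖((∫ ω, ‖dysonDefect ρ z v (blockTrace z v (A ω)) a b‖ ^ 2 ∂P : ℝ) : ℂ)‖ := by
        rw [Complex.norm_real, Real.norm_of_nonneg hnn]
    _ ≤ s ^ 3 * (n * (L * (σ + 5)) + n * (n * (30 * L * s ^ 2 * K))) + s ^ 4 * (2 * n * L) := by
        rw [e1]
        refine (norm_sub_le _ _).trans (add_le_add ?_ ?_)
        · rw [norm_mul, norm_pow, Complex.norm_real, Real.norm_of_nonneg hs0]
          exact mul_le_mul_of_nonneg_left hsum (by positivity)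
        · rw [norm_mul, norm_pow, Complex.norm_real, Real.norm_of_nonneg hs0]
          exact mul_le_mul_of_nonneg_left hrem' (by positivity)
    -- With `s = n^{-1/2}`, each `s² n` equals one: the diagonal and off-diagonal parts are of order
    -- `s`, the remainder of order `s²`.
    _ = s * (s ^ 2 * n) * (L * (σ + 5)) + s * (s ^ 2 * n) ^ 2 * (30 * L * K)
          + s ^ 2 * (s ^ 2 * n) * (2 * L) := by ring
    _ = s * (L * (σ + 5)) + s * (30 * L * K) + s ^ 2 * (2 * L) := by rw [hsn]; ring
    _ ≤ s * (L * (σ + 5)) + s * (30 * L * K) + s * (2 * L) := by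
        gcongr
        nlinarith
    _ = _ := by ring

end ConditionC0

/-! ### Contraction and stability for large `v` -/

section FixedPoint

theorem dysonDefect_eq_add (ρ : ℝ) (z : ℂ) (v : ℝ) (g : Bool → Bool → ℂ) (a b : Bool) :
    dysonDefect ρ z v g a b = dysonDefect ρ z 0 g a b + Complex.I * v * g a b := by
  unfold dysonDefect
  push_cast
  ring

theorem norm_apply_apply_le (g : Bool → Bool → ℂ) (a b : Bool) : ‖g a b‖ ≤ ‖g‖ :=
  (norm_le_pi_norm (g a) b).trans (norm_le_pi_norm g a)

theorem norm_le_of_forall_apply_le {g : Bool → Bool → ℂ} {r : ℝ} (hr : 0 ≤ r)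
    (h : ∀ a b, ‖g a b‖ ≤ r) : ‖g‖ ≤ r :=
  (pi_norm_le_iff_of_nonneg hr).2 fun a => (pi_norm_le_iff_of_nonneg hr).2 fun b => h a b

/-- The map whose fixed points are the zeros of the defect. -/
noncomputable def dysonMap (ρ : ℝ) (z : ℂ) (v : ℝ) (g : Bool → Bool → ℂ) : Bool → Bool → ℂ :=
  fun a b => -((Complex.I * v)⁻¹ * dysonDefect ρ z 0 g a b)

/-- Solving for the term `i v g` gives a map whose size and Lipschitz constant on the unit ball are
at most `v⁻¹ (‖z‖ + 4) ≤ 1/2`; Banach's theorem applies. -/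
theorem exists_dysonDefect_eq_zero {ρ : ℝ} (hρ : |ρ| ≤ 1) (z : ℂ) {v : ℝ}
    (hv : 2 * (‖z‖ + 4) ≤ v) :
    ∃ g : Bool → Bool → ℂ, (∀ a b, ‖g a b‖ ≤ 1) ∧ ∀ a b, dysonDefect ρ z v g a b = 0 := by
  have hz := norm_nonneg z
  have hv0 : 0 < v := by linarith
  have hinv : ‖(Complex.I * (v : ℂ))⁻¹‖ = v⁻¹ := by
    simp [abs_of_pos hv0]
  have hq : v⁻¹ * (‖z‖ + 0 + 4) ≤ 1 / 2 := by
    rw [inv_mul_le_iff₀ hv0]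
    linarith
  have hball : ∀ g ∈ Metric.closedBall (0 : Bool → Bool → ℂ) 1, ∀ a b, ‖g a b‖ ≤ 1 :=
    fun g hg a b => (norm_apply_apply_le g a b).trans (mem_closedBall_zero_iff.1 hg)
  have hmaps : Set.MapsTo (dysonMap ρ z v) (Metric.closedBall 0 1) (Metric.closedBall 0 1) := by
    intro g hg
    rw [mem_closedBall_zero_iff]
    refine norm_le_of_forall_apply_le zero_le_one fun a b => ?_
    rw [dysonMap, norm_neg, norm_mul, hinv]
    have := mul_le_mul_of_nonneg_left (norm_dysonDefect_le hρ z le_rfl (hball g hg) a b)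
      (inv_nonneg.2 hv0.le)
    linarith
  have hcontr : ContractingWith (1 / 2) (hmaps.restrict (dysonMap ρ z v) _ _) := by
    refine ⟨by norm_num, LipschitzWith.of_dist_le_mul ?_⟩
    rintro ⟨g, hg⟩ ⟨g', hg'⟩
    change dist (dysonMap ρ z v g) (dysonMap ρ z v g') ≤ _ * dist g g'
    rw [dist_eq_norm, dist_eq_norm]
    have hC : (((1 / 2 : ℝ≥0)) : ℝ) = 1 / 2 := by norm_num
    rw [hC]
    refine norm_le_of_forall_apply_le (by positivity) fun a b => ?_
    have h := norm_dysonDefect_sub_le hρ z le_rfl (hball g hg) (hball g' hg')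
      (fun a b => norm_apply_apply_le (g - g') a b) a b
    have e : (dysonMap ρ z v g - dysonMap ρ z v g') a b =
        -((Complex.I * v)⁻¹ * (dysonDefect ρ z 0 g a b - dysonDefect ρ z 0 g' a b)) := by
      simp only [Pi.sub_apply, dysonMap]
      ring
    rw [e, norm_neg, norm_mul, hinv]
    calc v⁻¹ * _ ≤ v⁻¹ * ((‖z‖ + 0 + 4) * ‖g - g'‖) := by gcongr
      _ = (v⁻¹ * (‖z‖ + 0 + 4)) * ‖g - g'‖ := by ring
      _ ≤ _ := by gcongr
  obtain ⟨g, hg, hfix, -⟩ := hcontr.exists_fixedPoint' Metric.isClosed_closedBall.isComplete hmaps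
    (x := 0) (by simp) (edist_ne_top _ _)
  refine ⟨g, hball g hg, fun a b => ?_⟩
  have h := congrFun (congrFun hfix a) b
  have hv' : (Complex.I * (v : ℂ)) ≠ 0 := by simp [hv0.ne']
  rw [dysonDefect_eq_add]
  rw [← h]
  rw [dysonMap, mul_neg, mul_inv_cancel_left₀ hv', add_neg_cancel]

/-- Subtracting the two equations gives `v ‖g - g'‖ ≤ S + (v/2) ‖g - g'‖`, and `v ≥ 8` absorbs the
last term. It also implies that the zero in the unit ball is unique. -/
theorem norm_sub_le_sum_dysonDefect {ρ : ℝ} (hρ : |ρ| ≤ 1) (z : ℂ) {v : ℝ}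
    (hv : 2 * (‖z‖ + 4) ≤ v) {g g' : Bool → Bool → ℂ} (hg : ∀ a b, ‖g a b‖ ≤ 1)
    (hg' : ∀ a b, ‖g' a b‖ ≤ 1) (h0 : ∀ a b, dysonDefect ρ z v g' a b = 0) (a b : Bool) :
    ‖g a b - g' a b‖ ≤ ∑ a, ∑ b, ‖dysonDefect ρ z v g a b‖ := by
  have hz := norm_nonneg z
  have hv0 : 0 < v := by linarith
  set S := ∑ a, ∑ b, ‖dysonDefect ρ z v g a b‖
  have hS0 : 0 ≤ S := Finset.sum_nonneg fun a _ => Finset.sum_nonneg fun b _ => norm_nonneg _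
  have hS : ∀ a b, ‖dysonDefect ρ z v g a b‖ ≤ S := fun a b =>
    (Finset.single_le_sum (f := fun b => ‖dysonDefect ρ z v g a b‖) (fun b _ => norm_nonneg _)
      (Finset.mem_univ b)).trans (Finset.single_le_sum
        (f := fun a => ∑ b, ‖dysonDefect ρ z v g a b‖)
        (fun a _ => Finset.sum_nonneg fun b _ => norm_nonneg _) (Finset.mem_univ a))
  have key : ∀ a b, v * ‖g a b - g' a b‖ ≤ S + v / 2 * ‖g - g'‖ := by
    intro a b
    have h := norm_dysonDefect_sub_le hρ z le_rfl hg hg'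
      (fun a b => norm_apply_apply_le (g - g') a b) a b
    have e : Complex.I * v * (g a b - g' a b) = dysonDefect ρ z v g a b -
        (dysonDefect ρ z 0 g a b - dysonDefect ρ z 0 g' a b) := by
      have := h0 a b
      rw [dysonDefect_eq_add] at this ⊢
      linear_combination -this
    have e2 : ‖Complex.I * v * (g a b - g' a b)‖ = v * ‖g a b - g' a b‖ := by
      simp [abs_of_pos hv0]
    rw [← e2, e]
    refine (norm_sub_le _ _).trans (add_le_add (hS a b) (h.trans ?_))
    gcongr
    linarith
  have h1 : v * ‖g - g'‖ ≤ S + v / 2 * ‖g - g'‖ := by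
    have : ‖g - g'‖ ≤ v⁻¹ * (S + v / 2 * ‖g - g'‖) :=
      norm_le_of_forall_apply_le (by positivity) fun a b => by
        rw [le_inv_mul_iff₀ hv0]
        exact key a b
    rwa [le_inv_mul_iff₀ hv0] at this
  have h2 : ‖g - g'‖ ≤ S := by nlinarith [norm_nonneg (g - g')]
  exact (norm_apply_apply_le (g - g') a b).trans h2

end FixedPoint

/-! ### Singular values in terms of the Hermitization -/

section SingularValues

variable {n : ℕ}

theorem sum_inner_eigenvectorBasis (S : Module.End ℂ (EuclideanSpace ℂ (Fin n)))
    (b : OrthonormalBasis (Fin n) ℂ (EuclideanSpace ℂ (Fin n))) :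
    ∑ i, inner ℂ (b i) (S (b i)) =
      ∑ k, inner ℂ (EuclideanSpace.single k (1 : ℂ)) (S (EuclideanSpace.single k 1)) := by
  rw [← LinearMap.trace_eq_sum_inner S b,
    LinearMap.trace_eq_sum_inner S (EuclideanSpace.basisFun (Fin n) ℂ)]
  simp

theorem sum_sq_singularValues (W : Matrix (Fin n) (Fin n) ℂ) :
    ∑ i : Fin n, (Matrix.toEuclideanLin W).singularValues i ^ 2 = ∑ i, ∑ j, ‖W i j‖ ^ 2 := by
  set T := Matrix.toEuclideanLin W
  have hn : Module.finrank ℂ (EuclideanSpace ℂ (Fin n)) = n := by simp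
  set hS := T.isSymmetric_adjoint_comp_self
  have h := sum_inner_eigenvectorBasis (LinearMap.adjoint T ∘ₗ T) (hS.eigenvectorBasis hn)
  have h1 : ∀ i, inner ℂ (hS.eigenvectorBasis hn i)
      ((LinearMap.adjoint T ∘ₗ T) (hS.eigenvectorBasis hn i)) =
      ((T.singularValues i ^ 2 : ℝ) : ℂ) := by
    intro i
    rw [hS.apply_eigenvectorBasis hn i, inner_smul_right, T.sq_singularValues_fin hn i]
    simp
  have h2 : ∀ k, inner ℂ (EuclideanSpace.single k (1 : ℂ))
      ((LinearMap.adjoint T ∘ₗ T) (EuclideanSpace.single k 1)) =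
      ((∑ i, ‖W i k‖ ^ 2 : ℝ) : ℂ) := by
    intro k
    rw [LinearMap.comp_apply, LinearMap.adjoint_inner_right, inner_self_eq_norm_sq_to_K,
      EuclideanSpace.norm_eq]
    norm_cast
    rw [Real.sq_sqrt (by positivity)]
    simp [T, Matrix.toEuclideanLin, Matrix.mulVec_single]
  simp_rw [h1, h2] at h
  rw [Finset.sum_comm]
  exact_mod_cast h

/-- Eliminating the other block from `(H - i v) R = 1` gives `(Wᴴ W + v²) R₂ = i v` for the lower
diagonal block `R₂`. Its trace is computed in an eigenbasis of `Wᴴ W`, whose eigenvalues are the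
squared singular values. -/
theorem sum_imagResolvent_hermitization (W : Matrix (Fin n) (Fin n) ℂ) {v : ℝ} (hv : v ≠ 0) :
    ∑ k, imagResolvent (hermitization W) v (true, k) (true, k) =
      Complex.I * v *
        ((∑ i : Fin n, ((Matrix.toEuclideanLin W).singularValues i ^ 2 + v ^ 2)⁻¹ : ℝ) : ℂ) := by
  set R := imagResolvent (hermitization W) v
  let R₁ : Matrix (Fin n) (Fin n) ℂ := Matrix.of fun k l => R (false, k) (true, l)
  let R₂ : Matrix (Fin n) (Fin n) ℂ := Matrix.of fun k l => R (true, k) (true, l)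
  have hR := sub_imag_mul_imagResolvent (isHermitian_hermitization W) hv
  change (hermitization W - (Complex.I * v) • 1) * R = 1 at hR
  have e1 : W * R₂ = (Complex.I * v) • R₁ := by
    ext k l
    have h := congrFun (congrFun hR (false, k)) (true, l)
    rw [sub_mul, Matrix.sub_apply, smul_mul_assoc, one_mul, Matrix.smul_apply, Matrix.mul_apply,
      Fintype.sum_prod_type] at h
    simp [hermitization] at h
    simp only [Matrix.mul_apply, R₁, R₂, Matrix.of_apply, Matrix.smul_apply, smul_eq_mul]
    linear_combination h
  have e2 : W.conjTranspose * R₁ = (Complex.I * v) • R₂ + 1 := by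
    ext k l
    have h := congrFun (congrFun hR (true, k)) (true, l)
    rw [sub_mul, Matrix.sub_apply, smul_mul_assoc, one_mul, Matrix.smul_apply, Matrix.mul_apply,
      Fintype.sum_prod_type] at h
    simp [hermitization, Matrix.one_apply] at h
    simp only [Matrix.mul_apply, R₁, R₂, Matrix.of_apply, Matrix.smul_apply, smul_eq_mul,
      Matrix.add_apply, Matrix.one_apply, Matrix.conjTranspose_apply, RCLike.star_def]
    linear_combination h
  have e3 : W.conjTranspose * W * R₂ = -((v : ℂ) ^ 2) • R₂ + (Complex.I * v) • 1 := by
    rw [mul_assoc, e1, mul_smul_comm, e2, smul_add, smul_smul]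
    congr 2
    linear_combination (v : ℂ) ^ 2 * Complex.I_sq
  set T := Matrix.toEuclideanLin W
  let Q := Matrix.toEuclideanLin R₂
  have hn : Module.finrank ℂ (EuclideanSpace ℂ (Fin n)) = n := by simp
  set hS := T.isSymmetric_adjoint_comp_self
  set b := hS.eigenvectorBasis hn
  have e4 : ∀ x, (LinearMap.adjoint T ∘ₗ T) (Q x) = -((v : ℂ) ^ 2) • Q x + (Complex.I * v) • x := by
    intro x
    rw [← Matrix.toEuclideanLin_conjTranspose_eq_adjoint]
    have := congrArg (fun M => Matrix.toEuclideanLin M x) e3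
    simp only [map_add, map_smul, LinearMap.add_apply, LinearMap.smul_apply] at this
    refine Eq.trans ?_ (this.trans ?_)
    · simp [T, Q, Matrix.toEuclideanLin]
    · simp [Q, Matrix.toEuclideanLin]
  have h := sum_inner_eigenvectorBasis Q b
  have h1 : ∀ i, inner ℂ (b i) (Q (b i)) =
      Complex.I * v * (((T.singularValues i ^ 2 + v ^ 2)⁻¹ : ℝ) : ℂ) := by
    intro i
    have e5 := congrArg (fun y => inner ℂ (b i) y) (e4 (b i))
    have e6 := hS (b i) (Q (b i))
    simp only [inner_add_right, inner_smul_right, orthonormal_iff_ite.1 b.orthonormal i i,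
      if_true] at e5
    rw [← e6, hS.apply_eigenvectorBasis hn i, inner_smul_left, ← T.sq_singularValues_fin hn i] at e5
    have hpos : T.singularValues i ^ 2 + v ^ 2 ≠ 0 := by positivity
    have hpos' : ((T.singularValues i : ℂ) ^ 2 + (v : ℂ) ^ 2) ≠ 0 := by exact_mod_cast hpos
    push_cast
    rw [eq_mul_inv_iff_mul_eq₀ hpos']
    simp at e5
    linear_combination e5
  have h2 : ∀ k, inner ℂ (EuclideanSpace.single k (1 : ℂ)) (Q (EuclideanSpace.single k 1)) =
      R (true, k) (true, k) := by
    intro k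
    rw [EuclideanSpace.inner_single_left]
    change _ * (R₂.mulVec (EuclideanSpace.single k (1 : ℂ)).ofLp) k = _
    simp [R₂]
  simp_rw [h1, h2] at h
  rw [← h, ← Finset.mul_sum]
  push_cast
  rfl

end SingularValues

/-! ### The empirical law on `[0, ∞)` -/

section SingularValueLaw

variable {n : ℕ}

/-- The empirical law of the singular values as a probability measure on `[0, ∞)`, in positive
dimension. -/
noncomputable def singularValueLawOfNeZero (hn : n ≠ 0) (W : Matrix (Fin n) (Fin n) ℂ) :
    ProbabilityMeasure ℝ≥0 :=
  ⟨(n : ℝ≥0∞)⁻¹ • ∑ i : Fin n,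
    Measure.dirac ((Matrix.toEuclideanLin W).singularValues i).toNNReal, ⟨by
      simp only [Measure.smul_apply, Measure.finsetSum_apply, measure_univ, Finset.sum_const,
        Finset.card_univ, Fintype.card_fin, nsmul_eq_mul, mul_one, smul_eq_mul]
      exact ENNReal.inv_mul_cancel (Nat.cast_ne_zero.2 hn) (ENNReal.natCast_ne_top n)⟩⟩

/-- The empirical law of the singular values as a probability measure on `[0, ∞)`
(the point mass at zero in dimension zero). -/
noncomputable def singularValueLaw (W : Matrix (Fin n) (Fin n) ℂ) : ProbabilityMeasure ℝ≥0 :=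
  if hn : n = 0 then diracProba 0 else singularValueLawOfNeZero hn W

theorem coe_singularValueLaw (hn : n ≠ 0) (W : Matrix (Fin n) (Fin n) ℂ) :
    (singularValueLaw W : Measure ℝ≥0) = (n : ℝ≥0∞)⁻¹ • ∑ i : Fin n,
      Measure.dirac ((Matrix.toEuclideanLin W).singularValues i).toNNReal := by
  rw [singularValueLaw, dif_neg hn]
  rfl

theorem map_singularValueLaw (hn : n ≠ 0) (W : Matrix (Fin n) (Fin n) ℂ) :
    (singularValueLaw W : Measure ℝ≥0).map ((↑) : ℝ≥0 → ℝ) = singularValueMeasure W := by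
  have hm : Measurable ((↑) : ℝ≥0 → ℝ) := measurable_coe_nnreal_real
  rw [coe_singularValueLaw hn, singularValueMeasure, Measure.map_smul]
  congr 1
  rw [← Measure.mapₗ_apply_of_measurable hm, map_sum]
  refine Finset.sum_congr rfl fun i _ => ?_
  rw [Measure.mapₗ_apply_of_measurable hm, Measure.map_dirac' hm,
    Real.coe_toNNReal _ (LinearMap.singularValues_nonneg _ _)]

theorem integral_singularValueLaw (hn : n ≠ 0) (W : Matrix (Fin n) (Fin n) ℂ) (f : ℝ≥0 → ℝ) :
    ∫ x, f x ∂(singularValueLaw W : Measure ℝ≥0) =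
      (n : ℝ)⁻¹ * ∑ i : Fin n, f ((Matrix.toEuclideanLin W).singularValues i).toNNReal := by
  rw [coe_singularValueLaw hn, integral_smul_measure, integral_finsetSum_measure]
  · simp
  · exact fun i _ => integrable_dirac (by simp)

theorem singularValueLaw_mem_secondMomentLE (hn : n ≠ 0) (W : Matrix (Fin n) (Fin n) ℂ) {C : ℝ≥0}
    (h : (n : ℝ)⁻¹ * ∑ i, ∑ j, ‖W i j‖ ^ 2 ≤ C) : singularValueLaw W ∈ secondMomentLE C := by
  change ∫⁻ x : ℝ≥0, (x : ℝ≥0∞) ^ 2 ∂(singularValueLaw W : Measure ℝ≥0) ≤ C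
  rw [coe_singularValueLaw hn, lintegral_smul_measure, lintegral_finsetSum_measure]
  simp only [lintegral_dirac, smul_eq_mul]
  rw [← sum_sq_singularValues] at h
  have h2 : (n : ℝ≥0)⁻¹ * ∑ i : Fin n,
      ((Matrix.toEuclideanLin W).singularValues i).toNNReal ^ 2 ≤ C := by
    rw [← NNReal.coe_le_coe]
    push_cast
    simpa only [Real.coe_toNNReal _ (LinearMap.singularValues_nonneg _ _)] using h
  have h3 := ENNReal.coe_le_coe.2 h2
  rw [ENNReal.coe_mul, ENNReal.coe_inv (Nat.cast_ne_zero.2 hn)] at h3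
  simpa only [ENNReal.coe_natCast, ENNReal.ofNNReal_finsetSum, ENNReal.coe_pow] using h3

theorem integral_inv_sq_add_singularValueLaw (hn : n ≠ 0) (A : Matrix (Fin n) (Fin n) ℝ) (z : ℂ)
    {v : ℝ} (hv : v ≠ 0) :
    ∫ x : ℝ≥0, ((x : ℝ) ^ 2 + v ^ 2)⁻¹ ∂(singularValueLaw (shiftedMatrix A z) : Measure ℝ≥0) =
      (blockTrace z v A true true).im / v := by
  rw [integral_singularValueLaw hn, blockTrace]
  simp only [hermResolvent, shiftedHerm]
  rw [sum_imagResolvent_hermitization _ hv]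
  simp only [Real.coe_toNNReal _ (LinearMap.singularValues_nonneg _ _)]
  set S := ∑ i : Fin n,
    ((Matrix.toEuclideanLin (shiftedMatrix A z)).singularValues i ^ 2 + v ^ 2)⁻¹
  have : (n : ℂ)⁻¹ * (Complex.I * v * (S : ℂ)) = (((n : ℝ)⁻¹ * v * S : ℝ) : ℂ) * Complex.I := by
    push_cast
    ring
  rw [this, Complex.im_ofReal_mul, Complex.I_im, mul_one]
  field_simp

theorem inv_mul_sum_norm_sq_shiftedMatrix_le (A : Matrix (Fin n) (Fin n) ℝ) (z : ℂ) :
    (n : ℝ)⁻¹ * ∑ i, ∑ j, ‖shiftedMatrix A z i j‖ ^ 2 ≤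
      2 * invSqrt n ^ 4 * ∑ i, ∑ j, A i j ^ 2 + 2 * ‖z‖ ^ 2 := by
  have h : ∀ i j, ‖shiftedMatrix A z i j‖ ^ 2 ≤
      2 * invSqrt n ^ 2 * A i j ^ 2 + if i = j then 2 * ‖z‖ ^ 2 else 0 := by
    intro i j
    have e : shiftedMatrix A z i j = ((invSqrt n * A i j : ℝ) : ℂ) - if i = j then z else 0 := by
      by_cases hij : i = j <;> simp [shiftedMatrix, invSqrt, hij]
    have h1 := norm_sub_le ((invSqrt n * A i j : ℝ) : ℂ) (if i = j then z else 0)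
    rw [← e, Complex.norm_real, Real.norm_eq_abs] at h1
    have h2 : |invSqrt n * A i j| ^ 2 = invSqrt n ^ 2 * A i j ^ 2 := by rw [sq_abs, mul_pow]
    split_ifs at h1 ⊢ with hij
    · nlinarith [norm_nonneg (shiftedMatrix A z i j), sq_nonneg (|invSqrt n * A i j| - ‖z‖)]
    · rw [norm_zero, add_zero] at h1
      nlinarith [norm_nonneg (shiftedMatrix A z i j), abs_nonneg (invSqrt n * A i j)]
  have h2 : ∑ i, ∑ j, ‖shiftedMatrix A z i j‖ ^ 2 ≤
      2 * invSqrt n ^ 2 * ∑ i, ∑ j, A i j ^ 2 + n * (2 * ‖z‖ ^ 2) := by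
    refine (Finset.sum_le_sum fun i _ => Finset.sum_le_sum fun j _ => h i j).trans (le_of_eq ?_)
    simp [Finset.sum_add_distrib, Finset.mul_sum]
  rw [← invSqrt_sq]
  have h3 : invSqrt n ^ 2 * n ≤ 1 := by
    rw [invSqrt_sq]
    exact inv_mul_le_one
  nlinarith [mul_le_mul_of_nonneg_left h2 (sq_nonneg (invSqrt n)),
    mul_le_mul_of_nonneg_right h3 (show 0 ≤ 2 * ‖z‖ ^ 2 by positivity)]

end SingularValueLaw

/-! ### Convergence in probability and the limit law -/

section Limit

/-- The threshold above which the self-consistent equation is a contraction. -/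
noncomputable def contractionThreshold (z : ℂ) : ℝ := 2 * (‖z‖ + 4)

theorem contractionThreshold_pos (z : ℂ) : 0 < contractionThreshold z := by
  unfold contractionThreshold
  positivity

theorem one_le_contractionThreshold (z : ℂ) : 1 ≤ contractionThreshold z := by
  unfold contractionThreshold
  linarith [norm_nonneg z]

theorem contractionThreshold_le_sqrt {z : ℂ} (t : Set.Ioi (contractionThreshold z ^ 2)) :
    contractionThreshold z ≤ √(t : ℝ) :=
  Real.le_sqrt_of_sq_le (le_of_lt t.2)

/-- The limit of `∫ (x² + t)⁻¹ dμ`, read off from the solution of the self-consistent equation. -/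
noncomputable def limitTransform {ρ : ℝ} (hρ : |ρ| ≤ 1) (z : ℂ)
    (t : Set.Ioi (contractionThreshold z ^ 2)) : ℝ :=
  ((exists_dysonDefect_eq_zero hρ z (contractionThreshold_le_sqrt t)).choose true true).im /
    √(t : ℝ)

namespace ConditionC0

variable {Ω : Type*} [MeasurableSpace Ω] {P : Measure Ω} {ρ M₄ : ℝ}
  {X : (n : ℕ) → Fin n → Fin n → Ω → ℝ}

theorem integral_diag_sq_eq (hX : ConditionC0 P ρ M₄ X) (n : ℕ) (i : Fin n) :
    ∫ ω, X n i i ω ^ 2 ∂P = ∫ ω, X 1 0 0 ω ^ 2 ∂P :=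
  ((hX.ident_diag n 1 i 0).comp (measurable_id.pow_const 2)).integral_eq

variable [IsProbabilityMeasure P]

theorem tendsto_measure_resolventTransform (hX : ConditionC0 P ρ M₄ X) (hρ : |ρ| ≤ 1) (z : ℂ)
    (t : Set.Ioi (contractionThreshold z ^ 2)) {δ : ℝ} (hδ : 0 < δ) :
    Tendsto (fun n => P {ω | δ ≤ |resolventTransform _
      (singularValueLaw (shiftedMatrix (sampleMatrix X n ω) z)) t - limitTransform hρ z t|})
      atTop (𝓝 0) := by
  have hvt := contractionThreshold_le_sqrt t
  have htv : (t : ℝ) = √(t : ℝ) ^ 2 :=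
    (Real.sq_sqrt ((sq_nonneg _).trans (le_of_lt t.2))).symm
  set v := √(t : ℝ) with hv_def
  have hv1 : 1 ≤ v := (one_le_contractionThreshold z).trans hvt
  have hv0 : 0 < v := by linarith
  obtain ⟨hg1, hg0⟩ := (exists_dysonDefect_eq_zero hρ z hvt).choose_spec
  have hlim : limitTransform hρ z t =
      ((exists_dysonDefect_eq_zero hρ z hvt).choose true true).im / v := rfl
  set g := (exists_dysonDefect_eq_zero hρ z hvt).choose
  set σ := ∫ ω, X 1 0 0 ω ^ 2 ∂P
  set C := (‖z‖ + v + 4) * (σ + 7 + 30 * (1 + 16 * |M₄|))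
  let f : (n : ℕ) → Ω → ℝ := fun n ω => ∑ a, ∑ b,
    ‖dysonDefect ρ z v (blockTrace z v (sampleMatrix X n ω)) a b‖ ^ 2
  have hDi : ∀ n a b, Integrable (fun ω =>
      ‖dysonDefect ρ z v (blockTrace z v (sampleMatrix X n ω)) a b‖ ^ 2) P := by
    intro n a b
    refine Integrable.of_bound (((measurable_dysonDefect_blockTrace ρ z v a b).comp
      (hX.measurable_sampleMatrix n)).norm.pow_const 2).aestronglyMeasurable ((‖z‖ + v + 4) ^ 2)
      (Eventually.of_forall fun ω => ?_)
    rw [norm_pow, norm_norm]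
    gcongr
    exact norm_dysonDefect_le hρ z hv0.le (norm_blockTrace_le hv1 _) a b
  have hfi : ∀ n, Integrable (f n) P := fun n =>
    integrable_finsetSum _ fun a _ => integrable_finsetSum _ fun b _ => hDi n a b
  have hfint : ∀ n, n ≠ 0 → ∫ ω, f n ω ∂P ≤ 4 * (C * invSqrt n) := by
    intro n hn
    have hb : ∀ a b, ∫ ω, ‖dysonDefect ρ z v (blockTrace z v (sampleMatrix X n ω)) a b‖ ^ 2 ∂P ≤
        C * invSqrt n := fun a b =>
      hX.integral_norm_sq_dysonDefect_le hρ hv1 a b hn fun i => (hX.integral_diag_sq_eq n i).le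
    simp only [f]
    rw [integral_finsetSum _ fun a _ => integrable_finsetSum _ fun b _ => hDi n a b,
      Finset.sum_congr rfl fun a _ => integral_finsetSum _ fun b _ => hDi n a b]
    simp only [Fintype.sum_bool]
    linarith [hb true true, hb true false, hb false true, hb false false]
  have hsub : ∀ n, n ≠ 0 → {ω | δ ≤ |resolventTransform _
      (singularValueLaw (shiftedMatrix (sampleMatrix X n ω) z)) t - limitTransform hρ z t|} ⊆
      {ω | δ ^ 2 / 4 ≤ f n ω} := by
    intro n hn ω hω
    have hω : δ ≤ |resolventTransform _
      (singularValueLaw (shiftedMatrix (sampleMatrix X n ω) z)) t - limitTransform hρ z t| := hω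
    have e : resolventTransform _ (singularValueLaw (shiftedMatrix (sampleMatrix X n ω) z)) t =
        (blockTrace z v (sampleMatrix X n ω) true true).im / v := by
      rw [← integral_inv_sq_add_singularValueLaw hn _ z hv0.ne', ← htv]
      rfl
    rw [e, hlim, ← sub_div, ← Complex.sub_im, abs_div, abs_of_pos hv0] at hω
    have h1 := norm_sub_le_sum_dysonDefect hρ z hvt
      (norm_blockTrace_le (z := z) hv1 (sampleMatrix X n ω)) hg1 hg0 true true
    have h2 := (div_le_self (abs_nonneg _) hv1).trans (Complex.abs_im_le_norm
      (blockTrace z v (sampleMatrix X n ω) true true - g true true))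
    have h3 := hω.trans (h2.trans h1)
    change δ ^ 2 / 4 ≤ f n ω
    simp only [f, Fintype.sum_bool] at h3 ⊢
    set x := ‖dysonDefect ρ z v (blockTrace z v (sampleMatrix X n ω)) true true‖
    set y := ‖dysonDefect ρ z v (blockTrace z v (sampleMatrix X n ω)) true false‖
    set u := ‖dysonDefect ρ z v (blockTrace z v (sampleMatrix X n ω)) false true‖
    set w := ‖dysonDefect ρ z v (blockTrace z v (sampleMatrix X n ω)) false false‖
    -- The square of a sum of four terms is at most four times the sum of squares, whence the level
    -- `δ² / 4`.
    have h4 : δ ^ 2 ≤ (x + y + (u + w)) ^ 2 := by gcongr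
    nlinarith [sq_nonneg (x - y), sq_nonneg (x - u), sq_nonneg (x - w), sq_nonneg (y - u),
      sq_nonneg (y - w), sq_nonneg (u - w)]
  have hbound : ∀ n, n ≠ 0 → P {ω | δ ≤ |resolventTransform _
      (singularValueLaw (shiftedMatrix (sampleMatrix X n ω) z)) t - limitTransform hρ z t|} ≤
      ENNReal.ofReal ((δ ^ 2 / 4)⁻¹ * (4 * (C * invSqrt n))) := by
    intro n hn
    refine (measure_mono (hsub n hn)).trans ?_
    rw [← ofReal_measureReal]
    refine ENNReal.ofReal_le_ofReal ?_
    rw [le_inv_mul_iff₀ (by positivity)]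
    refine (mul_meas_ge_le_integral_of_nonneg (Eventually.of_forall fun ω => ?_) (hfi n) _).trans
      (hfint n hn)
    exact Finset.sum_nonneg fun a _ => Finset.sum_nonneg fun b _ => by positivity
  have hs : Tendsto (fun n : ℕ => invSqrt n) atTop (𝓝 0) :=
    tendsto_inv_atTop_zero.comp (Real.tendsto_sqrt_atTop.comp tendsto_natCast_atTop_atTop)
  have hlim0 : Tendsto (fun n : ℕ => ENNReal.ofReal ((δ ^ 2 / 4)⁻¹ * (4 * (C * invSqrt n))))
      atTop (𝓝 0) := by
    have := ENNReal.tendsto_ofReal (((hs.const_mul C).const_mul 4).const_mul (δ ^ 2 / 4)⁻¹)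
    simpa using this
  refine tendsto_of_tendsto_of_tendsto_of_le_of_le' tendsto_const_nhds hlim0
    (Eventually.of_forall fun _ => zero_le) ?_
  filter_upwards [eventually_ne_atTop 0] with n hn using hbound n hn

theorem exists_measure_notMem_secondMomentLE_le (hX : ConditionC0 P ρ M₄ X) (z : ℂ) {η : ℝ}
    (hη : 0 < η) : ∃ C : ℝ≥0, ∀ n, n ≠ 0 →
      P {ω | singularValueLaw (shiftedMatrix (sampleMatrix X n ω) z) ∉ secondMomentLE C} ≤
        ENNReal.ofReal η := by
  set σ := ∫ ω, X 1 0 0 ω ^ 2 ∂P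
  have hσ0 : 0 ≤ σ := integral_nonneg fun ω => sq_nonneg _
  set B := 2 * (1 + σ) + 2 * ‖z‖ ^ 2
  have hB : 0 < B := by positivity
  -- `B` bounds the expected second moment uniformly in `n`, so Markov's inequality at level `B / η`
  -- leaves probability at most `η`.
  refine ⟨⟨B / η, by positivity⟩, fun n hn => ?_⟩
  let f : Ω → ℝ := fun ω => 2 * invSqrt n ^ 4 * ∑ i, ∑ j, X n i j ω ^ 2 + 2 * ‖z‖ ^ 2
  have hi : ∀ i j, Integrable (fun ω => X n i j ω ^ 2) P :=
    fun i j => (hX.memLp_two n i j).integrable_sq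
  have hsi : Integrable (fun ω => ∑ i, ∑ j, X n i j ω ^ 2) P :=
    integrable_finsetSum _ fun i _ => integrable_finsetSum _ fun j _ => hi i j
  have hfi : Integrable f P := (hsi.const_mul _).add (integrable_const _)
  have hint : ∀ i j, ∫ ω, X n i j ω ^ 2 ∂P ≤ 1 + σ := by
    intro i j
    by_cases hij : i = j
    · subst hij
      rw [hX.integral_diag_sq_eq]
      linarith
    · rw [hX.variance_offDiag n i j hij]
      linarith
  have hsn : invSqrt n ^ 4 * (n * (n * (1 + σ))) = 1 + σ := by
    have h : invSqrt n ^ 2 * n = 1 := by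
      rw [invSqrt_sq]
      exact inv_mul_cancel₀ (Nat.cast_ne_zero.2 hn)
    calc _ = (invSqrt n ^ 2 * n) ^ 2 * (1 + σ) := by ring
      _ = _ := by rw [h]; ring
  have hf : ∫ ω, f ω ∂P ≤ B := by
    simp only [f]
    rw [integral_add (hsi.const_mul _) (integrable_const _), integral_const_mul,
      integral_finsetSum _ fun i _ => integrable_finsetSum _ fun j _ => hi i j]
    simp only [integral_finsetSum _ fun j _ => hi _ j, integral_const, probReal_univ, one_smul]
    have h1 : ∑ i, ∑ j, ∫ ω, X n i j ω ^ 2 ∂P ≤ n * (n * (1 + σ)) := by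
      refine (Finset.sum_le_sum fun i _ => Finset.sum_le_sum fun j _ => hint i j).trans ?_
      simp only [Finset.sum_const, Finset.card_univ, Fintype.card_fin, nsmul_eq_mul, le_refl]
    have h2 := mul_le_mul_of_nonneg_left h1 (show 0 ≤ invSqrt n ^ 4 from
      pow_nonneg (invSqrt_nonneg n) 4)
    linarith
  have hsub : {ω | singularValueLaw (shiftedMatrix (sampleMatrix X n ω) z) ∉
      secondMomentLE ⟨B / η, by positivity⟩} ⊆ {ω | B / η ≤ f ω} := by
    intro ω hω
    by_contra hcon
    have hcon : f ω < B / η := not_le.1 hcon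
    exact hω (singularValueLaw_mem_secondMomentLE hn _
      ((inv_mul_sum_norm_sq_shiftedMatrix_le (sampleMatrix X n ω) z).trans hcon.le))
  refine (measure_mono hsub).trans ?_
  rw [← ofReal_measureReal]
  refine ENNReal.ofReal_le_ofReal ?_
  have hm := (mul_meas_ge_le_integral_of_nonneg (μ := P) (f := f) (Eventually.of_forall fun ω => by
    have := invSqrt_nonneg n
    change 0 ≤ f ω
    simp only [f]
    positivity) hfi (B / η)).trans hf
  rw [div_mul_eq_mul_div, div_le_iff₀ hη] at hm
  exact le_of_mul_le_mul_left hm hB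

theorem exists_eventually_measure_le (hX : ConditionC0 P ρ M₄ X) (hρ : |ρ| ≤ 1) (z : ℂ) {η : ℝ}
    (hη : 0 < η) : ∃ C : ℝ≥0, ∀ (S : Finset (Set.Ioi (contractionThreshold z ^ 2))) (δ : ℝ), 0 < δ →
      ∀ᶠ n in atTop, P {ω | ¬ (singularValueLaw (shiftedMatrix (sampleMatrix X n ω) z) ∈
          secondMomentLE C ∧ ∀ t ∈ S, |resolventTransform _
            (singularValueLaw (shiftedMatrix (sampleMatrix X n ω) z)) t -
              limitTransform hρ z t| < δ)} ≤ ENNReal.ofReal η := by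
  obtain ⟨C, hC⟩ := hX.exists_measure_notMem_secondMomentLE_le z (half_pos hη)
  refine ⟨C, fun S δ hδ => ?_⟩
  have hS := tendsto_finsetSum S fun t _ => hX.tendsto_measure_resolventTransform hρ z t hδ
  rw [Finset.sum_const_zero] at hS
  filter_upwards [eventually_ne_atTop 0, hS.eventually_le_const
    (ENNReal.ofReal_pos.2 (half_pos hη))] with n hn hn2
  rw [show η = η / 2 + η / 2 by ring, ENNReal.ofReal_add (by positivity) (by positivity)]
  refine (measure_mono ?_).trans ((measure_union_le _ _).trans (add_le_add (hC n hn)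
    ((measure_biUnion_finset_le S _).trans hn2)))
  intro ω hω
  by_cases hmem : singularValueLaw (shiftedMatrix (sampleMatrix X n ω) z) ∈ secondMomentLE C
  · right
    have hω : ¬ _ := hω
    simp only [hmem, true_and, not_forall, not_lt] at hω
    obtain ⟨t, ht, hle⟩ := hω
    exact Set.mem_biUnion ht hle
  · exact Or.inl hmem

/-- Existence by the probabilistic method: for large `n` the good event has positive probability, so
some outcome supplies a law with bounded second moment whose transform is close to the limit at
finitely many points. Compactness concludes. -/
theorem exists_resolventTransform_eq_limitTransform (hX : ConditionC0 P ρ M₄ X) (hρ : |ρ| ≤ 1)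
    (z : ℂ) : ∃ μ : ProbabilityMeasure ℝ≥0, resolventTransform _ μ = limitTransform hρ z := by
  obtain ⟨C, hC⟩ := hX.exists_eventually_measure_le hρ z (η := 1 / 2) (by norm_num)
  refine exists_resolventTransform_eq (pow_pos (contractionThreshold_pos z) 2) C _ fun S δ hδ => ?_
  obtain ⟨n, hn⟩ := (hC S δ hδ).exists
  by_contra! hcon
  have huniv : {ω | ¬ (singularValueLaw (shiftedMatrix (sampleMatrix X n ω) z) ∈
      secondMomentLE C ∧ ∀ t ∈ S, |resolventTransform _
        (singularValueLaw (shiftedMatrix (sampleMatrix X n ω) z)) t -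
          limitTransform hρ z t| < δ)} = Set.univ := by
    refine Set.eq_univ_of_forall fun ω hω => ?_
    obtain ⟨t, ht, hle⟩ := hcon _ hω.1
    exact absurd (hω.2 t ht) (not_lt.2 hle)
  rw [huniv, measure_univ] at hn
  have : ENNReal.ofReal (1 / 2) < 1 := by
    rw [← ENNReal.ofReal_one]
    exact (ENNReal.ofReal_lt_ofReal_iff one_pos).2 (by norm_num)
  exact absurd hn (not_le.2 this)

end ConditionC0

open Classical in
/-- The limiting law of the singular values on `[0, ∞)`: the measure whose transform is
`limitTransform`, which exists as soon as some sequence of matrices satisfies (C0). -/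
noncomputable def limitLaw {ρ : ℝ} (hρ : |ρ| ≤ 1) (z : ℂ) : ProbabilityMeasure ℝ≥0 :=
  if h : ∃ μ : ProbabilityMeasure ℝ≥0, resolventTransform _ μ = limitTransform hρ z then h.choose
  -- Harmless default: once some sequence satisfies (C0) with this `ρ`, the first branch applies.
  -- The choice itself refers only to `ρ` and `z`.
  else diracProba 0

theorem ConditionC0.resolventTransform_limitLaw {Ω : Type*} [MeasurableSpace Ω] {P : Measure Ω}
    [IsProbabilityMeasure P] {ρ M₄ : ℝ} {X : (n : ℕ) → Fin n → Fin n → Ω → ℝ}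
    (hX : ConditionC0 P ρ M₄ X) (hρ : |ρ| ≤ 1) (z : ℂ) :
    resolventTransform _ (limitLaw hρ z) = limitTransform hρ z := by
  have h := hX.exists_resolventTransform_eq_limitTransform hρ z
  rw [limitLaw, dif_pos h]
  exact h.choose_spec

/-- The distribution function on `ℝ` of the limiting law of the singular values. -/
noncomputable def limitDistribution {ρ : ℝ} (hρ : |ρ| ≤ 1) (z : ℂ) : StieltjesFunction ℝ :=
  cdf ((limitLaw hρ z : Measure ℝ≥0).map ((↑) : ℝ≥0 → ℝ))

theorem measure_limitDistribution {ρ : ℝ} (hρ : |ρ| ≤ 1) (z : ℂ) :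
    (limitDistribution hρ z).measure = (limitLaw hρ z : Measure ℝ≥0).map ((↑) : ℝ≥0 → ℝ) := by
  have : IsProbabilityMeasure ((limitLaw hρ z : Measure ℝ≥0).map ((↑) : ℝ≥0 → ℝ)) :=
    Measure.isProbabilityMeasure_map measurable_coe_nnreal_real.aemeasurable
  exact measure_cdf _

theorem isDistributionFunction_limitDistribution {ρ : ℝ} (hρ : |ρ| ≤ 1) (z : ℂ) :
    IsDistributionFunction (limitDistribution hρ z) :=
  ⟨tendsto_cdf_atBot _, tendsto_cdf_atTop _⟩

theorem ConditionC0.tendsto_measure_integral_singularValueMeasure {Ω : Type*} [MeasurableSpace Ω]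
    {P : Measure Ω} [IsProbabilityMeasure P] {ρ M₄ : ℝ} {X : (n : ℕ) → Fin n → Fin n → Ω → ℝ}
    (hX : ConditionC0 P ρ M₄ X) (hρ : |ρ| ≤ 1) (z : ℂ) (f : ℝ →ᵇ ℂ) {ε : ℝ} (hε : 0 < ε) :
    Tendsto (fun n : ℕ => P {ω | ε <
      ‖(∫ x, f x ∂(singularValueMeasure (shiftedMatrix (sampleMatrix X n ω) z))) -
        ∫ x, f x ∂(limitDistribution hρ z).measure‖}) atTop (𝓝 0) := by
  have hpush : ∀ μ : Measure ℝ≥0, ∫ x, f x ∂(μ.map ((↑) : ℝ≥0 → ℝ)) = ∫ x : ℝ≥0, f x ∂μ :=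
    fun μ => integral_map measurable_coe_nnreal_real.aemeasurable
      f.continuous.measurable.aestronglyMeasurable
  rw [ENNReal.tendsto_nhds_zero]
  intro η hη
  obtain ⟨η', hη', hle⟩ : ∃ η' : ℝ, 0 < η' ∧ ENNReal.ofReal η' ≤ η := by
    obtain ⟨r, hr, hr'⟩ := ENNReal.lt_iff_exists_nnreal_btwn.1 hη
    exact ⟨r, by exact_mod_cast hr, by rw [ENNReal.ofReal_coe_nnreal]; exact hr'.le⟩
  obtain ⟨C, hC⟩ := hX.exists_eventually_measure_le hρ z hη'
  obtain ⟨S, δ, hδ, hS⟩ := exists_finset_integral_close (pow_pos (contractionThreshold_pos z) 2) C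
    (limitLaw hρ z) (f.compContinuous ⟨((↑) : ℝ≥0 → ℝ), NNReal.continuous_coe⟩) hε
  rw [hX.resolventTransform_limitLaw hρ z] at hS
  filter_upwards [hC S δ hδ, eventually_ne_atTop 0] with n hn hn0
  -- On the good event, closeness of finitely many transforms and the moment bound force the
  -- integrals of `f` to differ by less than `ε`.
  refine (measure_mono fun ω hω hgood => ?_).trans (hn.trans hle)
  have hω : ε < ‖(∫ x, f x ∂(singularValueMeasure (shiftedMatrix (sampleMatrix X n ω) z))) -
    ∫ x, f x ∂(limitDistribution hρ z).measure‖ := hω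
  rw [← map_singularValueLaw hn0, measure_limitDistribution, hpush, hpush] at hω
  exact absurd (hS _ hgood.1 hgood.2) (not_lt.2 hω.le)

end Limit

theorem mainTheorem4 (ρ : ℝ) (hρ : |ρ| ≤ 1) :
    ∃ F : ℂ → StieltjesFunction ℝ, (∀ z, IsDistributionFunction (F z)) ∧
      ∀ (Ω : Type*) [MeasurableSpace Ω] (P : Measure Ω) [IsProbabilityMeasure P] (M₄ : ℝ)
        (X : (n : ℕ) → Fin n → Fin n → Ω → ℝ), ConditionC0 P ρ M₄ X →
        ∀ᵐ z : ℂ, ∀ (f : ℝ →ᵇ ℂ) (ε : ℝ), 0 < ε →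
          Tendsto (fun n : ℕ => P {ω | ε <
            ‖(∫ x, f x ∂(singularValueMeasure
                (shiftedMatrix (Matrix.of fun i j => X n i j ω) z))) -
              ∫ x, f x ∂(F z).measure‖}) atTop (𝓝 0) :=
  ⟨limitDistribution hρ, isDistributionFunction_limitDistribution hρ,
    fun _ _ _ _ _ _ hX => Eventually.of_forall fun z f _ hε =>
      hX.tendsto_measure_integral_singularValueMeasure hρ z f hε⟩
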